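/- \textbf{Setting.} Fix a countably infinite set of constants (distinct constants denote distinct objects; they are identified with natural numbers) and a predicate signature containing a special $0$-ary predicate $\bot$, which stands for falsity. A \emph{database} is a finite set of facts (ground atoms) not containing $\bot$. A \emph{conjunctive query} (CQ) is a formula $\exists \vec y\,\gamma$ with $\gamma$ a nonempty conjunction of predicate atoms and inequalities $t\neq t'$, and every variable of $\vec y$ occurring in $\gamma$. A \emph{dependency} is a sentence $\forall\vec x\,(\gamma\to q_1\vee\dots\vee q_m)$, $m\ge 1$, where $\gamma$ is a conjunction of predicate atoms and inequalities whose variables $\vec x$ all occur in predicate atoms of $\gamma$, and the $q_i$ are CQs with free variables among $\vec x$, each of whose quantified variables is distinct from the variables $\vec x$ and occurs in a predicate atom of $q_i$. It is \emph{full} if $m=1$ and every variable of $q_1$ occurs in $\gamma$. Let $\Sigma$ be a finite set of dependencies, and let $\mathrm{Pred}(\Sigma)$ be the set of predicates occurring in $\Sigma$, together with $\bot$. A database $D'$ is a \emph{repair} of $\langle\Sigma,D\rangle$ if it is a maximal subset of $D$ satisfying $\Sigma$. We write $\langle\Sigma,D\rangle\models q(\vec t)$ if $q(\vec t)$ is true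 in every (possibly infinite) model of $\Sigma$ that contains $D$, where $\bot$ is false in every model. FO formulas are relational calculus formulas (with constants and equality); $I\models\varphi(\vec t)$ is evaluated with quantifiers ranging over all constants. An FO formula $\varphi$ is \emph{domain-independent on} a set of facts $I$ if for all values of its free variables its truth value over $I$ does not change when the quantifiers are restricted to any nonempty set of constants containing those of $I$, those of $\varphi$, and the values of the free variables. An \emph{FO-rewriting} of a CQ $q(\vec x)$ w.r.t. $\Sigma$ is an FO formula $\varphi$ with free variables among $\vec x$ such that, for every database $D$, $\varphi$ is domain-independent on $D$ and, for every tuple $\vec t$ of constants, $\langle\Sigma,D\rangle\models q(\vec t)$ iff $D\models\varphi(\vec t)$. $\Sigma$ is \emph{CQ-FO-rewritable} if every CQ has an FO-rewriting w.r.t. $\Sigma$. For each predicate $p$ let $\tilde p$ be an auxiliary predicate of the same arity, and let $\mathrm{aux}(\cdot)$ replace every $p$ by $\tilde p$. Given an FO-rewriting $R_p(\vec x)$ of the atomic query $p(\vec x)$ for each $p\in\mathrm{Pred}(\Sigma)$, put $$\Phi^{wc}(\Sigma)=\bigwedge_{p\in\mathrm{Pred}(\Sigma)}\forall\vec x\,\bigl(\mathrm{aux}(R_p)(\vec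 x)\to p(\vec x)\bigr),$$ let $\Phi^{wc}(\{\tilde p(\vec y)\},\Sigma)$, with $\vec y$ fresh variables, be obtained from $\Phi^{wc}(\Sigma)$ by replacing every atom $\tilde p(\vec t)$ by $\tilde p(\vec t)\vee \vec t=\vec y$, and put $$\Phi^{rc}(\Sigma)=\Phi^{wc}(\Sigma)\wedge\bigwedge_{p\in\mathrm{Pred}(\Sigma)}\neg\exists\vec y\,\bigl(p(\vec y)\wedge\neg\tilde p(\vec y)\wedge\Phi^{wc}(\{\tilde p(\vec y)\},\Sigma)\bigr).$$ \textbf{Theorem.} Let $\Sigma$ be a finite CQ-FO-rewritable set of full dependencies. Then: (1) For every choice of FO-rewritings $R_p$ of the atomic queries, $p\in\mathrm{Pred}(\Sigma)$, $\Phi^{rc}(\Sigma)$ is an FO sentence such that, for all databases $D,D'$ over $\mathrm{Pred}(\Sigma)$, it is domain-independent on $D\cup\mathrm{aux}(D')$, and $D\cup\mathrm{aux}(D')\models\Phi^{rc}(\Sigma)$ iff $D'$ is a repair of $\langle\Sigma,D\rangle$. (2) Hence repair checking for $\Sigma$ is FO-rewritable, i.e. some FO sentence has the property stated in (1). (3)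 Hence repair checking for $\Sigma$ is in $\mathrm{AC}^0$ in data complexity: for fixed $\Sigma$, the language of the encodings of pairs $(D,D')$ of databases over $\mathrm{Pred}(\Sigma)$ such that $D'$ is a repair of $\langle\Sigma,D\rangle$ is decided by a logspace-uniform family of Boolean circuits of unbounded fan-in, polynomial size and constant depth. Here a pair $(D,D')$ is encoded as a list of its facts, in any order, each marked as belonging to $D$ or to $D'$, with constants written in binary with a common number $w$ of bits sufficient for all of them, the list being preceded by $1^w0$. -/

import Mathlib

/-! # Databases, dependencies, first-order rewritings, repairs, and uniform AC⁰ -/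

namespace RepairChecking

/-! ## Signatures, terms, atoms, facts -/

/-- The constants form a countably infinite set; distinct constants denote distinct objects. -/
abbrev Const := ℕ

abbrev Var := ℕ

/-- A predicate signature; it always contains the special predicate `⊥` of arity 0. -/
structure Signature where
  Pred : Type
  [decEqPred : DecidableEq Pred]
  arity : Pred → ℕ
  bot : Pred
  arity_bot : arity bot = 0

attribute [instance] Signature.decEqPred

inductive Term where
  | var (x : Var)
  | const (c : Const)

namespace Term

def eval (v : Var → Const) : Term → Const
  | var x => v x
  | const c => c

def vars : Term → Set Var
  | var x => {x}
  | const _ => ∅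

def consts : Term → Set Const
  | var _ => ∅
  | const c => {c}

/-- A number strictly above every variable of the term. -/
def varBound : Term → ℕ
  | var x => x + 1
  | const _ => 0

end Term

/-- A predicate atom. -/
structure Atom (S : Signature) where
  pred : S.Pred
  args : Fin (S.arity pred) → Term

/-- A fact, i.e. a ground atom. -/
structure Fact (S : Signature) where
  pred : S.Pred
  args : Fin (S.arity pred) → Const

namespace Atom

variable {S : Signature}

def vars (a : Atom S) : Set Var := ⋃ i, (a.args i).vars

/-- The fact obtained by instantiating the variables of the atom. -/
def inst (v : Var → Const) (a : Atom S) : Fact S := ⟨a.pred, fun i => (a.args i).eval v⟩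

end Atom

/-- The constants occurring in a set of facts. -/
def adom {S : Signature} (I : Set (Fact S)) : Set Const :=
  {c | ∃ f ∈ I, ∃ i, f.args i = c}

/-- A database: a finite set of facts that does not contain `⊥`. -/
def IsDatabase {S : Signature} (D : Set (Fact S)) : Prop :=
  D.Finite ∧ ∀ f ∈ D, f.pred ≠ S.bot

/-! ## Conjunctive queries with inequalities -/

/-- A (nonempty) conjunction of predicate atoms and of inequalities `t ≠ t'`. -/
structure Conj (S : Signature) where
  atoms : List (Atom S)
  ineqs : List (Term × Term)
  nonempty : atoms ≠ [] ∨ ineqs ≠ []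

namespace Conj

variable {S : Signature}

/-- The variables that occur in some predicate atom. -/
def atomVars (g : Conj S) : Set Var := {x | ∃ a ∈ g.atoms, x ∈ a.vars}

def vars (g : Conj S) : Set Var :=
  g.atomVars ∪ {x | ∃ e ∈ g.ineqs, x ∈ e.1.vars ∪ e.2.vars}

def Holds (g : Conj S) (I : Set (Fact S)) (v : Var → Const) : Prop :=
  (∀ a ∈ g.atoms, a.inst v ∈ I) ∧ ∀ e ∈ g.ineqs, e.1.eval v ≠ e.2.eval v

/-- The predicates occurring in a conjunction. -/
def preds (g : Conj S) : List S.Pred := g.atoms.map Atom.pred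

end Conj

/-- A conjunctive query `∃ y (γ)`, every variable of `y` occurring in `γ`. -/
structure CQ (S : Signature) where
  conj : Conj S
  ex : List Var
  ex_mem : ∀ x ∈ ex, x ∈ conj.vars

namespace CQ

variable {S : Signature}

def freeVars (q : CQ S) : Set Var := {x | x ∈ q.conj.vars ∧ x ∉ q.ex}

/-- `q` is true in `I`, its free variables being instantiated by `v`. -/
def Holds (q : CQ S) (I : Set (Fact S)) (v : Var → Const) : Prop :=
  ∃ v' : Var → Const, (∀ x, x ∉ q.ex → v' x = v x) ∧ q.conj.Holds I v'

/-- The atomic query `p(x₀, …, x₍ₖ₋₁₎)`, with free variables `x₀, …, x₍ₖ₋₁₎`. -/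
def atomic (p : S.Pred) : CQ S where
  conj := ⟨[⟨p, fun i => Term.var i⟩], [], Or.inl (by simp)⟩
  ex := []
  ex_mem := by simp

end CQ

/-! ## Dependencies -/

/-- A disjunctive embedded dependency with inequalities `∀ x (γ → q₁ ∨ … ∨ qₘ)`, `m ≥ 1`.
The body is safe, and so is each disjunct once the universally quantified variables are
instantiated; existential variables are named apart from the universal ones. -/
structure Dependency (S : Signature) where
  body : Conj S
  head : List (CQ S)
  head_nonempty : head ≠ []
  body_safe : body.vars ⊆ body.atomVars
  head_free : ∀ q ∈ head, q.freeVars ⊆ body.vars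
  head_safe : ∀ q ∈ head, ∀ x ∈ q.ex, x ∈ q.conj.atomVars
  head_apart : ∀ q ∈ head, ∀ x ∈ q.ex, x ∉ body.vars

namespace Dependency

variable {S : Signature}

def Satisfied (d : Dependency S) (I : Set (Fact S)) : Prop :=
  ∀ v : Var → Const, d.body.Holds I v → ∃ q ∈ d.head, q.Holds I v

/-- Full (non-disjunctive): a single disjunct, all of whose variables occur in the body. -/
def IsFull (d : Dependency S) : Prop :=
  ∃ q, d.head = [q] ∧ q.conj.vars ⊆ d.body.vars

def preds (d : Dependency S) : List S.Pred :=
  d.body.preds ++ d.head.flatMap fun q => q.conj.preds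

end Dependency

variable {S : Signature}

/-- `I` satisfies every dependency. -/
def Consistent (deps : List (Dependency S)) (I : Set (Fact S)) : Prop :=
  ∀ d ∈ deps, d.Satisfied I

/-- The predicates occurring in the dependencies, together with `⊥`, without repetitions. -/
def predList (deps : List (Dependency S)) : List S.Pred :=
  (S.bot :: deps.flatMap Dependency.preds).dedup

/-- A database all of whose predicates occur in the dependencies. -/
def IsDatabaseOver (deps : List (Dependency S)) (D : Set (Fact S)) : Prop :=
  IsDatabase D ∧ ∀ f ∈ D, f.pred ∈ predList deps

/-- `D'` is a repair of `⟨Σ, D⟩`: a maximal subset of `D` consistent with `Σ`. -/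
def IsRepair (deps : List (Dependency S)) (D D' : Set (Fact S)) : Prop :=
  Maximal (fun X => X ⊆ D ∧ Consistent deps X) D'

/-- Classical entailment `⟨Σ, D⟩ ⊨ q`, the free variables of `q` being instantiated by `v`:
`q` is true in every (possibly infinite) model of `Σ` that contains the facts of `D`;
`⊥` is false in every model. -/
def Entails (deps : List (Dependency S)) (D : Set (Fact S)) (q : CQ S)
    (v : Var → Const) : Prop :=
  ∀ I : Set (Fact S), D ⊆ I → (∀ f ∈ I, f.pred ≠ S.bot) → Consistent deps I → q.Holds I v

/-! ## First-order formulas (relational calculus) -/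

inductive Formula (S : Signature) where
  | fls
  | atom (a : Atom S)
  | eq (s t : Term)
  | neg (φ : Formula S)
  | and (φ ψ : Formula S)
  | ex (x : Var) (φ : Formula S)

namespace Formula

/-- Evaluation over the set of facts `I`, with quantifiers ranging over `U`. -/
def SatIn (U : Set Const) (I : Set (Fact S)) : (Var → Const) → Formula S → Prop
  | _, fls => False
  | v, atom a => a.inst v ∈ I
  | v, eq s t => s.eval v = t.eval v
  | v, neg φ => ¬ SatIn U I v φ
  | v, and φ ψ => SatIn U I v φ ∧ SatIn U I v ψ
  | v, ex x φ => ∃ c ∈ U, SatIn U I (Function.update v x c) φ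

/-- Evaluation over `I`, with quantifiers ranging over all constants. -/
def Sat (I : Set (Fact S)) (v : Var → Const) (φ : Formula S) : Prop :=
  φ.SatIn Set.univ I v

def freeVars : Formula S → Set Var
  | fls => ∅
  | atom a => a.vars
  | eq s t => s.vars ∪ t.vars
  | neg φ => φ.freeVars
  | and φ ψ => φ.freeVars ∪ ψ.freeVars
  | ex x φ => φ.freeVars \ {x}

/-- The constants occurring in a formula. -/
def consts : Formula S → Set Const
  | fls => ∅
  | atom a => ⋃ i, (a.args i).consts
  | eq s t => s.consts ∪ t.consts
  | neg φ => φ.consts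
  | and φ ψ => φ.consts ∪ ψ.consts
  | ex _ φ => φ.consts

/-- A number strictly above every variable (free or bound) of the formula. -/
def varBound : Formula S → ℕ
  | fls => 0
  | atom a => Finset.univ.sup fun i => (a.args i).varBound
  | eq s t => max s.varBound t.varBound
  | neg φ => φ.varBound
  | and φ ψ => max φ.varBound ψ.varBound
  | ex x φ => max (x + 1) φ.varBound

def or (φ ψ : Formula S) : Formula S := neg (and (neg φ) (neg ψ))

def imp (φ ψ : Formula S) : Formula S := neg (and φ (neg ψ))

def all (x : Var) (φ : Formula S) : Formula S := neg (ex x (neg φ))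

def tru : Formula S := neg fls

/-- Conjunction of a list of formulas. -/
def conj (l : List (Formula S)) : Formula S := l.foldr and tru

/-- `∃ x_m … x_{m+k-1} φ`. -/
def exRange (m k : ℕ) (φ : Formula S) : Formula S :=
  (List.range k).foldr (fun i ψ => ex (m + i) ψ) φ

/-- `∀ x_m … x_{m+k-1} φ`. -/
def allRange (m k : ℕ) (φ : Formula S) : Formula S :=
  (List.range k).foldr (fun i ψ => all (m + i) ψ) φ

/-- `φ` is domain-independent on `I`: its truth value, for any values of its free variables,
does not change when the quantifiers are restricted to a nonempty domain that contains the
constants of `I`, those of `φ`, and the values of the free variables. -/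
def DomainIndependentOn (φ : Formula S) (I : Set (Fact S)) : Prop :=
  ∀ (U : Set Const) (v : Var → Const), U.Nonempty → adom I ⊆ U → φ.consts ⊆ U →
    (∀ x ∈ φ.freeVars, v x ∈ U) → (φ.SatIn U I v ↔ φ.Sat I v)

end Formula

/-- `φ` is an FO-rewriting of the conjunctive query `q` with respect to `Σ`: an FO query with
the free variables of `q` which, evaluated over any database `D`, holds at exactly the tuples
`t` with `⟨Σ, D⟩ ⊨ q(t)`. -/
def IsRewriting (deps : List (Dependency S)) (q : CQ S) (φ : Formula S) : Prop :=
  φ.freeVars ⊆ q.freeVars ∧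
    ∀ D : Set (Fact S), IsDatabase D →
      φ.DomainIndependentOn D ∧ ∀ v : Var → Const, Entails deps D q v ↔ φ.Sat D v

/-- Classical conjunctive query answering over `Σ` is FO-rewritable. -/
def CQFORewritable (deps : List (Dependency S)) : Prop :=
  ∀ q : CQ S, ∃ φ : Formula S, IsRewriting deps q φ

/-! ## The auxiliary alphabet and the repair-checking sentence -/

/-- The signature with an additional auxiliary copy `Sum.inr p` of every predicate `p`. -/
def Signature.withAux (S : Signature) : Signature where
  Pred := S.Pred ⊕ S.Pred
  arity := Sum.elim S.arity S.arity
  bot := Sum.inl S.bot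
  arity_bot := S.arity_bot

/-- `p(t)` over the extended signature. -/
def Atom.plain (a : Atom S) : Atom S.withAux := ⟨Sum.inl a.pred, a.args⟩

/-- The atom `p(t)` rewritten to the auxiliary alphabet. -/
def Atom.aux (a : Atom S) : Atom S.withAux := ⟨Sum.inr a.pred, a.args⟩

def Fact.plain (f : Fact S) : Fact S.withAux := ⟨Sum.inl f.pred, f.args⟩

def Fact.aux (f : Fact S) : Fact S.withAux := ⟨Sum.inr f.pred, f.args⟩

/-- The set of facts `D ∪ aux(D')`. -/
def pairInstance (D D' : Set (Fact S)) : Set (Fact S.withAux) :=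
  Fact.plain '' D ∪ Fact.aux '' D'

/-- Every atom is replaced by the corresponding auxiliary atom. -/
def Formula.aux : Formula S → Formula S.withAux
  | .fls => .fls
  | .atom a => .atom a.aux
  | .eq s t => .eq s t
  | .neg φ => .neg φ.aux
  | .and φ ψ => .and φ.aux ψ.aux
  | .ex x φ => .ex x φ.aux

/-- The atom `p(x_m, …, x_{m+k-1})`. -/
def varAtom (p : S.Pred) (m : ℕ) : Atom S := ⟨p, fun i => Term.var (m + i)⟩

/-- Every auxiliary atom `r~(t)` is replaced by `r~(t) ∨ σ`, where `σ` is the unifier of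
`r~(t)` and `p~(x_m, …, x_{m+k-1})`, i.e. `⋀ᵢ tᵢ = x_{m+i}` if `r = p`, and false otherwise. -/
def Formula.insertAux (p : S.Pred) (m : ℕ) : Formula S.withAux → Formula S.withAux
  | .fls => .fls
  | .atom ⟨Sum.inl r, t⟩ => .atom ⟨Sum.inl r, t⟩
  | .atom ⟨Sum.inr r, t⟩ =>
      .or (.atom ⟨Sum.inr r, t⟩)
        (if r = p then
          .conj (List.ofFn fun i : Fin (S.arity r) => .eq (t i) (.var (m + (i : ℕ))))
        else .fls)
  | .eq s t => .eq s t
  | .neg φ => .neg (φ.insertAux p m)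
  | .and φ ψ => .and (φ.insertAux p m) (ψ.insertAux p m)
  | .ex x φ => .ex x (φ.insertAux p m)

/-- The sentence `Φʷᶜ_p = ∀ x (q_p(x) → p(x))`, where `R p` is a rewriting of the atomic query
`p(x)` and `q_p` is `R p` over the auxiliary alphabet. -/
def phiWcPred (R : S.Pred → Formula S) (p : S.Pred) : Formula S.withAux :=
  .allRange 0 (S.arity p) (.imp (R p).aux (.atom (varAtom p 0).plain))

/-- The sentence `Φʷᶜ(Σ)`. -/
def phiWc (deps : List (Dependency S)) (R : S.Pred → Formula S) : Formula S.withAux :=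
  .conj ((predList deps).map (phiWcPred R))

/-- The sentence `Φʳᶜ(Σ)`, namely
`Φʷᶜ(Σ) ∧ ⋀_p ¬ ∃ y (p(y) ∧ ¬ p~(y) ∧ Φʷᶜ({p~(y)}, Σ))`, with fresh variables `y`. -/
def phiRc (deps : List (Dependency S)) (R : S.Pred → Formula S) : Formula S.withAux :=
  let W := phiWc deps R
  let m := W.varBound
  .and W (.conj ((predList deps).map fun p =>
    .neg (.exRange m (S.arity p)
      (.and (.atom (varAtom p m).plain)
        (.and (.neg (.atom (varAtom p m).aux)) (W.insertAux p m))))))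

/-- The FO sentence `Φ` is a rewriting of repair checking for `Σ`: evaluated over
`D ∪ aux(D')`, it is true iff `D'` is a repair of `⟨Σ, D⟩`. -/
def IsRepairRewriting (deps : List (Dependency S)) (Φ : Formula S.withAux) : Prop :=
  Φ.freeVars = ∅ ∧
    ∀ D D' : Set (Fact S), IsDatabaseOver deps D → IsDatabaseOver deps D' →
      Φ.DomainIndependentOn (pairInstance D D') ∧
        ∀ v : Var → Const, Φ.Sat (pairInstance D D') v ↔ IsRepair deps D D'

/-- Repair checking for `Σ` is FO-rewritable. -/
def RepairCheckingFORewritable (deps : List (Dependency S)) : Prop :=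
  ∃ Φ : Formula S.withAux, IsRepairRewriting deps Φ

/-! ## Logarithmic space

Deterministic while-programs over finitely many registers holding natural numbers, with a
write-only output. The space used is the number of bits stored in the registers. -/

inductive Expr where
  | const (k : ℕ)
  | reg (r : ℕ)
  | add (e f : Expr)
  | sub (e f : Expr)
  | mul (e f : Expr)

/-- Value of an expression in the register state `s` (`sub` is truncated subtraction). -/
def Expr.eval (s : ℕ → ℕ) : Expr → ℕ
  | const k => k
  | reg r => s r
  | add e f => e.eval s + f.eval s
  | sub e f => e.eval s - f.eval s
  | mul e f => e.eval s * f.eval s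

inductive Prog where
  | skip
  | assign (r : ℕ) (e : Expr)
  | emit (e : Expr)
  | seq (p q : Prog)
  | ite (e : Expr) (p q : Prog)
  | while (e : Expr) (p : Prog)

/-- `Run b p s out s'`: started in the state `s`, the program `p` halts in the state `s'` with
output `out`, and no register is ever assigned a number of more than `b` bits. A test `e`
succeeds iff its value is not zero. -/
inductive Run (b : ℕ) : Prog → (ℕ → ℕ) → List ℕ → (ℕ → ℕ) → Prop
  | skip (s) : Run b .skip s [] s
  | assign (r e s) : (Expr.eval s e).size ≤ b →
      Run b (.assign r e) s [] (Function.update s r (e.eval s))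
  | emit (e s) : Run b (.emit e) s [e.eval s] s
  | seq {p q s s' s'' o o'} : Run b p s o s' → Run b q s' o' s'' →
      Run b (.seq p q) s (o ++ o') s''
  | ite_true {e p q s s' o} : e.eval s ≠ 0 → Run b p s o s' → Run b (.ite e p q) s o s'
  | ite_false {e p q s s' o} : e.eval s = 0 → Run b q s o s' → Run b (.ite e p q) s o s'
  | while_true {e p s s' s'' o o'} : e.eval s ≠ 0 → Run b p s o s' →
      Run b (.while e p) s' o' s'' → Run b (.while e p) s (o ++ o') s''
  | while_false {e p s} : e.eval s = 0 → Run b (.while e p) s [] s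

/-- The function that maps the unary input `1ⁿ` to the word `f n` is computable in
logarithmic space. -/
def LogspaceComputable (f : ℕ → List ℕ) : Prop :=
  ∃ (p : Prog) (k : ℕ), ∀ n : ℕ, ∃ s' : ℕ → ℕ,
    Run (k * (Nat.log 2 n + 1)) p (Function.update (fun _ => 0) 0 n) (f n) s'

/-! ## Boolean circuits and AC⁰ -/

/-- Boolean circuits with unbounded fan-in, unfolded into trees (at constant depth, unfolding
keeps polynomial size, so that the class AC⁰ is the same). -/
inductive Circuit where
  | input (i : ℕ)
  | not (c : Circuit)
  | and (cs : List Circuit)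
  | or (cs : List Circuit)

namespace Circuit

mutual
/-- Value of a circuit on the input word `w`. -/
def eval (w : List Bool) : Circuit → Bool
  | input i => w.getD i false
  | not c => !(eval w c)
  | and cs => evalAnd w cs
  | or cs => evalOr w cs
def evalAnd (w : List Bool) : List Circuit → Bool
  | [] => true
  | c :: cs => eval w c && evalAnd w cs
def evalOr (w : List Bool) : List Circuit → Bool
  | [] => false
  | c :: cs => eval w c || evalOr w cs
end

mutual
/-- Number of gates. -/
def size : Circuit → ℕ
  | input _ => 1
  | not c => size c + 1
  | and cs => sizeList cs + 1
  | or cs => sizeList cs + 1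
def sizeList : List Circuit → ℕ
  | [] => 0
  | c :: cs => size c + sizeList cs
end

mutual
/-- Depth: the largest number of gates on a path from the output to an input. -/
def depth : Circuit → ℕ
  | input _ => 0
  | not c => depth c + 1
  | and cs => depthList cs + 1
  | or cs => depthList cs + 1
def depthList : List Circuit → ℕ
  | [] => 0
  | c :: cs => max (depth c) (depthList cs)
end

mutual
/-- Description of a circuit as a word, in prefix notation. -/
def code : Circuit → List ℕ
  | input i => [0, i]
  | not c => 1 :: code c
  | and cs => 2 :: (codeList cs ++ [4])
  | or cs => 3 :: (codeList cs ++ [4])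
def codeList : List Circuit → List ℕ
  | [] => []
  | c :: cs => code c ++ codeList cs
end

end Circuit

/-- The language `L` is in AC⁰: it is decided by a logspace-uniform family of unbounded fan-in
circuits of polynomial size and constant depth. -/
def InAC0 (L : Set (List Bool)) : Prop :=
  ∃ C : ℕ → Circuit,
    (∃ c : ℕ, ∀ n, (C n).size ≤ c * (n + 1) ^ c) ∧
    (∃ d : ℕ, ∀ n, (C n).depth ≤ d) ∧
    LogspaceComputable (fun n => (C n).code) ∧
    ∀ w : List Bool, w ∈ L ↔ (C w.length).eval w = true

/-! ## Repair checking as a language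

A pair `(D, D')` is presented as a list of records, one for each fact, in any order. A record
holds a bit that tells `D` (`false`) from `D'` (`true`), the predicate (one bit for each
predicate of `Σ`), and the arguments, each in binary with `w` bits, padded with zeros up to the
largest arity. The list of records is preceded by `1ʷ0`. -/

/-- The largest arity of a predicate of `Σ`. -/
def maxArity (deps : List (Dependency S)) : ℕ :=
  ((predList deps).map S.arity).foldr max 0

/-- The `w` lowest binary digits of `c`. -/
def bits (w c : ℕ) : List Bool := (List.range w).map fun j => c.testBit j

/-- The `i`-th argument of a fact, or `0` if there is none. -/
def Fact.argD (f : Fact S) (i : ℕ) : Const :=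
  if h : i < S.arity f.pred then f.args ⟨i, h⟩ else 0

def encodeRecord (deps : List (Dependency S)) (w : ℕ) (e : Bool × Fact S) : List Bool :=
  e.1 :: ((predList deps).map (fun p => decide (e.2.pred = p)) ++
    (List.range (maxArity deps)).flatMap fun i => bits w (e.2.argD i))

def encode (deps : List (Dependency S)) (w : ℕ) (es : List (Bool × Fact S)) : List Bool :=
  List.replicate w true ++ false :: es.flatMap (encodeRecord deps w)

/-- The word `s` encodes the pair `(D, D')`. -/
def Encodes (deps : List (Dependency S)) (s : List Bool) (D D' : Set (Fact S)) : Prop :=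
  ∃ (w : ℕ) (es : List (Bool × Fact S)),
    (∀ e ∈ es, ∀ i, e.2.args i < 2 ^ w) ∧
    D = {f | (false, f) ∈ es} ∧ D' = {f | (true, f) ∈ es} ∧ s = encode deps w es

/-- The problem of repair checking for the fixed set `Σ` (data complexity): given (an encoding
of) two databases `D` and `D'`, is `D'` a repair of `⟨Σ, D⟩`? -/
def repairLanguage (deps : List (Dependency S)) : Set (List Bool) :=
  {s | ∃ D D' : Set (Fact S), IsDatabaseOver deps D ∧ IsDatabaseOver deps D' ∧
    Encodes deps s D D' ∧ IsRepair deps D D'}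

end RepairChecking

namespace RepairChecking

variable {S : Signature}

/-! ## Finiteness of the constants involved -/

-- Full dependencies behave like Horn rules: a head has no existential variables and no
-- alternatives, so models in which `⊥` is false are closed under intersection. Hence, as soon as
-- `D'` has a model, the facts common to all models form a least model, `derivable deps D'`; if
-- there is none, every fact is derivable, in particular `⊥`.
--
-- Call `D'` weakly consistent in `D` if everything derivable from it lies in `D`. Since `D` omits
-- `⊥`, the closure of such a `D'` is a consistent subset of `D`. It follows that `D'` is a repair
-- exactly when it is weakly consistent and no single fact of `D` outside `D'` can be added while
-- keeping weak consistency (`isRepair_iff_weaklyConsistent`). The rewritings of the atomic queries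
-- define derivability, so `Φʷᶜ` defines weak consistency; replacing auxiliary atoms by disjunctions
-- simulates the addition of one fact (`satIn_insertAux`), and `Φʳᶜ` defines repairs.
--
-- Domain independence needs one more argument: the outer quantifiers of `Φʷᶜ` must not miss a
-- derivable fact when restricted to a set `U`. Full rules create only constants of the rule heads,
-- and a permutation argument shows that the arguments of derivable facts even lie among the
-- constants of the database and of the given rewriting (`arg_mem_of_derivable`). `satIn_phiRc`
-- therefore holds uniformly in `U`.
--
-- For AC⁰, circuit families are described by templates: finite expressions whose loops range over
-- `0, …, n - 1`. Expansion has constant depth and polynomial size, and nested loops with counters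
-- at most `n` print it in logarithmic space (`inAC0_of_template`). A template guesses the bit
-- width, checks that the word is an encoding, and evaluates the sentence with quantifiers
-- restricted to finitely many fixed constants and the numbers readable at input positions; domain
-- independence makes this restriction harmless.

theorem Term.finite_consts (t : Term) : t.consts.Finite := by
  cases t <;> simp [Term.consts]

theorem Formula.finite_consts (φ : Formula S) : φ.consts.Finite := by
  induction φ with
  | fls => exact Set.finite_empty
  | atom a => exact Set.finite_iUnion fun i => (a.args i).finite_consts
  | eq s t => exact s.finite_consts.union t.finite_consts
  | neg φ ih => exact ih
  | and φ ψ ih₁ ih₂ => exact ih₁.union ih₂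
  | ex x φ ih => exact ih

theorem finite_adom {I : Set (Fact S)} (h : I.Finite) : (adom I).Finite := by
  have : adom I = ⋃ f ∈ I, Set.range f.args := by
    ext c; simp [adom]
  rw [this]
  exact h.biUnion fun f _ => Set.finite_range _

/-- The constants in the atoms of the heads of the dependencies. -/
def headConsts (deps : List (Dependency S)) : Set Const :=
  {c | ∃ d ∈ deps, ∃ q ∈ d.head, ∃ a ∈ q.conj.atoms, ∃ i, c ∈ (a.args i).consts}

theorem finite_headConsts (deps : List (Dependency S)) : (headConsts deps).Finite := by
  have : headConsts deps = ⋃ d ∈ {d | d ∈ deps}, ⋃ q ∈ {q | q ∈ d.head},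
      ⋃ a ∈ {a | a ∈ q.conj.atoms}, ⋃ i, (a.args i).consts := by
    ext c; simp [headConsts]
  rw [this]
  exact (List.finite_toSet _).biUnion fun d _ => (List.finite_toSet _).biUnion fun q _ =>
    (List.finite_toSet _).biUnion fun a _ => Set.finite_iUnion fun i => (a.args i).finite_consts

/-! ## Full dependencies and their least models -/

/-- An existential variable of the head would occur in the body by fullness and be apart from it by
`head_apart`. So there is none, and satisfaction becomes an implication between two conjunctions
under the same assignment. -/
theorem Dependency.IsFull.exists_head {d : Dependency S} (h : d.IsFull) :
    ∃ q, d.head = [q] ∧ q.conj.vars ⊆ d.body.vars ∧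
      ∀ I, d.Satisfied I ↔ ∀ v, d.body.Holds I v → q.conj.Holds I v := by
  obtain ⟨q, hq, hv⟩ := h
  refine ⟨q, hq, hv, fun I => ?_⟩
  have hex : q.ex = [] := by
    rw [List.eq_nil_iff_forall_not_mem]
    intro x hx
    exact d.head_apart q (by simp [hq]) x hx (hv (q.ex_mem x hx))
  have hh : ∀ v, q.Holds I v ↔ q.conj.Holds I v := by
    intro v
    unfold CQ.Holds
    simp only [hex, List.not_mem_nil, not_false_eq_true, forall_const]
    constructor
    · rintro ⟨v', h1, h2⟩
      rwa [← show v' = v from funext h1]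
    · exact fun h => ⟨v, fun _ => rfl, h⟩
  simp [Dependency.Satisfied, hq, hh]

/-- `I` is a model of the dependencies that contains `D` and in which `⊥` is false. -/
def IsModel (deps : List (Dependency S)) (D I : Set (Fact S)) : Prop :=
  D ⊆ I ∧ (∀ f ∈ I, f.pred ≠ S.bot) ∧ Consistent deps I

/-- The facts that hold in all models. -/
def derivable (deps : List (Dependency S)) (D : Set (Fact S)) : Set (Fact S) :=
  {f | ∀ I, IsModel deps D I → f ∈ I}

variable {deps : List (Dependency S)} {D D' I K : Set (Fact S)}

theorem subset_derivable : D ⊆ derivable deps D := fun _ hf _ hI => hI.1 hf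

theorem derivable_subset (h : IsModel deps D I) : derivable deps D ⊆ I := fun _ hf => hf I h

/-- An intersection of models is a model, because a rule firing in the intersection fires in each of
them with the same head instance. One actual model is needed for `⊥` to stay out and for the head
inequalities, which do not depend on the set of facts. -/
theorem isModel_derivable (hfull : ∀ d ∈ deps, d.IsFull) (h : IsModel deps D I) :
    IsModel deps D (derivable deps D) := by
  refine ⟨subset_derivable, fun f hf => h.2.1 f (hf I h), fun d hd => ?_⟩
  obtain ⟨q, -, -, hsat⟩ := (hfull d hd).exists_head
  rw [hsat]
  intro v hv
  have key : ∀ J, IsModel deps D J → q.conj.Holds J v := fun J hJ =>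
    (hsat J).1 (hJ.2.2 d hd) v ⟨fun a ha => hv.1 a ha J hJ, hv.2⟩
  exact ⟨fun a ha J hJ => (key J hJ).1 a ha, (key I h).2⟩

/-- A device for bounding the least model: any `K` that contains `D` and is closed under the rules,
inequalities disregarded, contains every derivable fact. It is applied below with `K` restricting
predicates and with `K` restricting arguments. -/
theorem Consistent.inter (hfull : ∀ d ∈ deps, d.IsFull) (h : Consistent deps I)
    (hK : ∀ d ∈ deps, ∀ v, (∀ a ∈ d.body.atoms, a.inst v ∈ K) →
      ∀ q ∈ d.head, q.conj.vars ⊆ d.body.vars → ∀ a ∈ q.conj.atoms, a.inst v ∈ K) :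
    Consistent deps (I ∩ K) := by
  intro d hd
  obtain ⟨q, hq, hvars, hsat⟩ := (hfull d hd).exists_head
  rw [hsat]
  intro v hv
  have h1 := (hsat I).1 (h d hd) v ⟨fun a ha => (hv.1 a ha).1, hv.2⟩
  exact ⟨fun a ha => ⟨h1.1 a ha, hK d hd v (fun a ha => (hv.1 a ha).2) q (by simp [hq])
    hvars a ha⟩, h1.2⟩

theorem IsModel.inter (hfull : ∀ d ∈ deps, d.IsFull) (h : IsModel deps D I) (hD : D ⊆ K)
    (hK : ∀ d ∈ deps, ∀ v, (∀ a ∈ d.body.atoms, a.inst v ∈ K) →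
      ∀ q ∈ d.head, q.conj.vars ⊆ d.body.vars → ∀ a ∈ q.conj.atoms, a.inst v ∈ K) :
    IsModel deps D (I ∩ K) :=
  ⟨Set.subset_inter h.1 hD, fun f hf => h.2.1 f hf.1, h.2.2.inter hfull hK⟩

theorem bot_mem_predList : S.bot ∈ predList deps := by simp [predList]

theorem pred_mem_predList {d : Dependency S} (hd : d ∈ deps) {q : CQ S} (hq : q ∈ d.head)
    {a : Atom S} (ha : a ∈ q.conj.atoms) : a.pred ∈ predList deps := by
  simp only [predList, List.mem_dedup, List.mem_cons, List.mem_flatMap]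
  refine Or.inr ⟨d, hd, ?_⟩
  simp only [Dependency.preds, List.mem_append, List.mem_flatMap]
  exact Or.inr ⟨q, hq, List.mem_map_of_mem ha⟩

theorem pred_mem_of_mem_derivable (hfull : ∀ d ∈ deps, d.IsFull) (h : IsModel deps D I)
    (hD : ∀ f ∈ D, f.pred ∈ predList deps) {f : Fact S} (hf : f ∈ derivable deps D) :
    f.pred ∈ predList deps :=
  (hf _ (h.inter (K := {f | f.pred ∈ predList deps}) hfull hD
    fun _ hd _ _ _ hq _ _ ha => pred_mem_predList hd hq ha)).2

/-- Full rules invent no values: by fullness and safety each head variable occurs in a body atom, so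
a head argument is copied from a body fact or is a constant of the rule. -/
theorem args_mem_of_mem_derivable (hfull : ∀ d ∈ deps, d.IsFull) (h : IsModel deps D I)
    {f : Fact S} (hf : f ∈ derivable deps D) (i) : f.args i ∈ adom D ∪ headConsts deps := by
  refine (hf _ (h.inter (K := {f | ∀ i, f.args i ∈ adom D ∪ headConsts deps}) hfull ?_ ?_)).2 i
  · exact fun f hf i => Or.inl ⟨f, hf, i, rfl⟩
  · intro d hd v hbody q hq hvars a ha j
    have hvar : ∀ x ∈ d.body.vars, v x ∈ adom D ∪ headConsts deps := by
      intro x hx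
      obtain ⟨b, hb, hxb⟩ := d.body_safe hx
      obtain ⟨i, hi⟩ := Set.mem_iUnion.1 hxb
      have h2 := hbody b hb i
      have h3 : b.args i = .var x := by
        cases hbi : b.args i with
        | var y => simp [hbi, Term.vars] at hi; rw [hi]
        | const c => simp [hbi, Term.vars] at hi
      simpa [Atom.inst, h3, Term.eval] using h2
    change (a.args j).eval v ∈ _
    cases haj : a.args j with
    | var x =>
      refine hvar x (hvars (Or.inl ⟨a, ha, Set.mem_iUnion.2 ⟨j, ?_⟩⟩))
      simp [haj, Term.vars]
    | const c => exact Or.inr ⟨d, hd, q, hq, a, ha, j, by simp [haj, Term.consts, Term.eval]⟩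

theorem entails_atomic_iff (p : S.Pred) (v : Var → Const) :
    Entails deps D (CQ.atomic p) v ↔ (⟨p, fun i => v i⟩ : Fact S) ∈ derivable deps D := by
  have : ∀ I : Set (Fact S), (CQ.atomic p).Holds I v ↔ (⟨p, fun i => v i⟩ : Fact S) ∈ I := by
    intro I
    simp only [CQ.Holds, CQ.atomic, List.not_mem_nil, not_false_eq_true, forall_const, Conj.Holds,
      List.mem_singleton, forall_eq, Atom.inst, Term.eval, false_imp_iff, implies_true, and_true]
    constructor
    · rintro ⟨v', h1, h2⟩
      rwa [← show v' = v from funext h1]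
    · exact fun h => ⟨v, fun _ => rfl, h⟩
  simp only [Entails, this, derivable, IsModel, Set.mem_ofPred_eq, and_imp]

/-! ## Genericity -/

/-- A permutation of the constants, applied to a fact. -/
def Fact.perm (π : Equiv.Perm Const) (f : Fact S) : Fact S := ⟨f.pred, fun i => π (f.args i)⟩

theorem Term.eval_comp_perm (π : Equiv.Perm Const) (v : Var → Const) (t : Term)
    (h : ∀ c ∈ t.consts, π c = c) : t.eval (π ∘ v) = π (t.eval v) := by
  cases t with
  | var x => rfl
  | const c => exact (h c rfl).symm

theorem Formula.satIn_comp_perm (π : Equiv.Perm Const) (hI : ∀ f, Fact.perm π f ∈ I ↔ f ∈ I)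
    (φ : Formula S) (hc : ∀ c ∈ φ.consts, π c = c) (v : Var → Const) :
    φ.SatIn Set.univ I (π ∘ v) ↔ φ.SatIn Set.univ I v := by
  induction φ generalizing v with
  | fls => rfl
  | atom a =>
    have : a.inst (π ∘ v) = (a.inst v).perm π := by
      unfold Atom.inst Fact.perm
      congr 1
      funext i
      exact (a.args i).eval_comp_perm π v fun c h => hc c (Set.mem_iUnion.2 ⟨i, h⟩)
    simp only [SatIn, this, hI]
  | eq s t =>
    simp only [SatIn]
    rw [s.eval_comp_perm π v fun c h => hc c (Or.inl h),
      t.eval_comp_perm π v fun c h => hc c (Or.inr h), π.injective.eq_iff]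
  | neg φ ih => simp only [SatIn, ih hc]
  | and φ ψ ih₁ ih₂ =>
    simp only [SatIn, ih₁ fun c h => hc c (Or.inl h), ih₂ fun c h => hc c (Or.inr h)]
  | ex x φ ih =>
    have hupd : ∀ c, Function.update (π ∘ v) x (π c) = π ∘ Function.update v x c := fun c =>
      (Function.comp_update π v x c).symm
    simp only [SatIn, Set.mem_univ, true_and]
    rw [π.surjective.exists]
    simp only [hupd, ih hc]

/-- An argument outside the constants of `D` and `φ` is indistinguishable from a fresh constant for
`φ`. Swapping the two would make a fact with the fresh constant derivable, against
`args_mem_of_mem_derivable`. The bound thus mentions the constants of `φ` in place of those of the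
rule heads, which a restricted quantifier domain need not contain. -/
theorem arg_mem_of_derivable (hfull : ∀ d ∈ deps, d.IsFull) (hD : IsDatabase D)
    (h : IsModel deps D I) {p : S.Pred} {φ : Formula S} (hφ : IsRewriting deps (CQ.atomic p) φ)
    {v : Var → Const} (hv : (⟨p, fun i => v i⟩ : Fact S) ∈ derivable deps D)
    (i : Fin (S.arity p)) : v i ∈ adom D ∪ φ.consts := by
  classical
  by_contra hi
  have hdi := hφ.2 D hD
  -- Unlike `v i`, which may be a constant of a rule head, `e` also avoids `headConsts deps`; this
  -- asymmetry gives the contradiction.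
  obtain ⟨e, he⟩ := ((finite_adom hD.1).union (φ.finite_consts.union
    (finite_headConsts deps))).exists_notMem
  have he1 : e ∉ adom D := fun h => he (Or.inl h)
  have he2 : e ∉ φ.consts := fun h => he (Or.inr (Or.inl h))
  have he3 : e ∉ headConsts deps := fun h => he (Or.inr (Or.inr h))
  have hfix : ∀ c, c ∈ adom D ∪ φ.consts → Equiv.swap (v i) e c = c := by
    intro c hc
    refine Equiv.swap_apply_of_ne_of_ne ?_ ?_
    · rintro rfl; exact hi hc
    · rintro rfl; exact hc.elim he1 he2
  have hfixD : ∀ f ∈ D, Fact.perm (Equiv.swap (v i) e) f = f := by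
    rintro ⟨r, t⟩ hf
    unfold Fact.perm
    congr 1
    funext j
    exact hfix _ (Or.inl ⟨_, hf, j, rfl⟩)
  have hmem : ∀ f, Fact.perm (Equiv.swap (v i) e) f ∈ D ↔ f ∈ D := by
    intro f
    constructor
    · intro hf
      have h1 := hfixD _ hf
      have h2 : Fact.perm (Equiv.swap (v i) e) (Fact.perm (Equiv.swap (v i) e) f) = f := by
        simp [Fact.perm]
      rwa [← h2, h1]
    · intro hf
      rwa [hfixD f hf]
  have hs := (hdi.2 v).1 ((entails_atomic_iff p v).2 hv)
  have hs' := (φ.satIn_comp_perm (Equiv.swap (v i) e) hmem (fun c hc => hfix c (Or.inr hc)) v).2 hs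
  have hd := (entails_atomic_iff p _).1 ((hdi.2 _).2 hs')
  have := args_mem_of_mem_derivable hfull h hd i
  simp only [Function.comp_apply, Equiv.swap_apply_left] at this
  exact this.elim he1 he3

/-! ## Semantics of the formula constructions -/

theorem Fact.plain_injective : Function.Injective (Fact.plain (S := S)) := by
  rintro ⟨p, a⟩ ⟨q, b⟩ h
  cases h
  rfl

theorem Fact.aux_injective : Function.Injective (Fact.aux (S := S)) := by
  rintro ⟨p, a⟩ ⟨q, b⟩ h
  cases h
  rfl

theorem Fact.plain_ne_aux (f g : Fact S) : f.plain ≠ g.aux := by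
  intro h
  have := congrArg Fact.pred h
  exact Sum.inl_ne_inr this

theorem plain_mem_pairInstance {f : Fact S} : f.plain ∈ pairInstance D D' ↔ f ∈ D := by
  simp only [pairInstance, Set.mem_union, Fact.plain_injective.mem_set_image, or_iff_left_iff_imp]
  rintro ⟨g, -, h⟩
  exact absurd h.symm (Fact.plain_ne_aux _ _)

theorem aux_mem_pairInstance {f : Fact S} : f.aux ∈ pairInstance D D' ↔ f ∈ D' := by
  simp only [pairInstance, Set.mem_union, Fact.aux_injective.mem_set_image, or_iff_right_iff_imp]
  rintro ⟨g, -, h⟩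
  exact absurd h (Fact.plain_ne_aux _ _)

theorem pairInstance_insert (f : Fact S) :
    pairInstance D (insert f D') = insert f.aux (pairInstance D D') := by
  simp [pairInstance, Set.image_insert_eq, Set.union_insert]

theorem adom_pairInstance : adom (pairInstance D D') = adom D ∪ adom D' := by
  ext c
  simp only [adom, pairInstance, Set.mem_union, Set.mem_image, Set.mem_ofPred_eq]
  constructor
  · rintro ⟨f, ⟨g, hg, rfl⟩ | ⟨g, hg, rfl⟩, i, hi⟩
    · exact Or.inl ⟨g, hg, i, hi⟩
    · exact Or.inr ⟨g, hg, i, hi⟩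
  · rintro (⟨g, hg, i, hi⟩ | ⟨g, hg, i, hi⟩)
    · exact ⟨_, Or.inl ⟨g, hg, rfl⟩, i, hi⟩
    · exact ⟨_, Or.inr ⟨g, hg, rfl⟩, i, hi⟩

namespace Formula

variable {U : Set Const} {J : Set (Fact S)} {v : Var → Const}

theorem satIn_aux {φ : Formula S} :
    φ.aux.SatIn U (pairInstance D D') v ↔ φ.SatIn U D' v := by
  induction φ generalizing v with
  | fls => rfl
  | atom a => exact aux_mem_pairInstance (f := a.inst v)
  | eq s t => rfl
  | neg φ ih => simp only [aux, SatIn, ih]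
  | and φ ψ ih₁ ih₂ => simp only [aux, SatIn, ih₁, ih₂]
  | ex x φ ih => simp only [aux, SatIn, ih]

theorem satIn_imp {φ ψ : Formula S} :
    (imp φ ψ).SatIn U J v ↔ (φ.SatIn U J v → ψ.SatIn U J v) := by
  simp [imp, SatIn]

theorem satIn_or {φ ψ : Formula S} :
    (Formula.or φ ψ).SatIn U J v ↔ (φ.SatIn U J v ∨ ψ.SatIn U J v) := by
  simp only [Formula.or, SatIn]; tauto

theorem satIn_all {x : Var} {φ : Formula S} :
    (all x φ).SatIn U J v ↔ ∀ c ∈ U, φ.SatIn U J (Function.update v x c) := by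
  simp [all, SatIn]

theorem satIn_conj {l : List (Formula S)} :
    (conj l).SatIn U J v ↔ ∀ φ ∈ l, φ.SatIn U J v := by
  induction l with
  | nil => simp [conj, tru, SatIn]
  | cons a l ih =>
    simp only [conj, List.foldr_cons, SatIn, List.mem_cons, forall_eq_or_imp] at ih ⊢
    rw [ih]

/-- The assignment that maps `x_{m+i}` to `t i`, for `i < k`, and is `v` elsewhere. -/
def assignRange (m : ℕ) {k : ℕ} (t : Fin k → Const) (v : Var → Const) : Var → Const :=
  fun x : ℕ => if h : m ≤ x ∧ x - m < k then t ⟨x - m, h.2⟩ else v x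

theorem assignRange_apply (m : ℕ) {k : ℕ} (t : Fin k → Const) (i : Fin k) :
    assignRange m t v (m + i) = t i := by
  simp [assignRange]

theorem update_assignRange_castSucc (m : ℕ) {k : ℕ} (t : Fin (k + 1) → Const) :
    Function.update (assignRange m (fun i => t i.castSucc) v) (m + k) (t (Fin.last k)) =
      assignRange m t v := by
  funext (x : ℕ)
  by_cases hx : x = m + k
  · subst hx
    rw [Function.update_self]
    exact (assignRange_apply m t (Fin.last k)).symm
  · rw [Function.update_of_ne hx]
    unfold assignRange
    by_cases h : m ≤ x ∧ x - m < k
    · rw [dif_pos h, dif_pos ⟨h.1, by omega⟩]; rfl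
    · rw [dif_neg h, dif_neg (by omega)]

theorem satIn_exRange {m k : ℕ} {φ : Formula S} :
    (exRange m k φ).SatIn U J v ↔
      ∃ t : Fin k → Const, (∀ i, t i ∈ U) ∧ φ.SatIn U J (assignRange m t v) := by
  induction k generalizing φ with
  | zero =>
    have : ∀ t : Fin 0 → Const, assignRange m t v = v := by
      intro t; funext x; simp [assignRange]
    simp [exRange, this]
  | succ k ih =>
    -- The variable of largest index is the innermost one, so the induction absorbs it into `φ`.
    have : exRange m (k + 1) φ = exRange m k (ex (m + k) φ) := by
      simp [exRange, List.range_succ]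
    rw [this, ih]
    simp only [SatIn]
    constructor
    · rintro ⟨t, ht, c, hc, h⟩
      refine ⟨Fin.snoc (α := fun _ => Const) t c, fun i => ?_, ?_⟩
      · refine Fin.lastCases ?_ (fun i => ?_) i
        · simpa using hc
        · simpa using ht i
      · rw [← update_assignRange_castSucc]
        simpa using h
    · rintro ⟨t, ht, h⟩
      refine ⟨fun i => t i.castSucc, fun i => ht _, t (Fin.last k), ht _, ?_⟩
      rwa [update_assignRange_castSucc]

theorem satIn_allRange {m k : ℕ} {φ : Formula S} :
    (allRange m k φ).SatIn U J v ↔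
      ∀ t : Fin k → Const, (∀ i, t i ∈ U) → φ.SatIn U J (assignRange m t v) := by
  have key : ∀ (l : List ℕ) (v : Var → Const),
      (l.foldr (fun i ψ => all (m + i) ψ) φ).SatIn U J v ↔
        ¬ (l.foldr (fun i ψ => ex (m + i) ψ) (neg φ)).SatIn U J v := by
    intro l
    induction l with
    | nil => simp [SatIn]
    | cons a l ih =>
      intro v
      simp only [List.foldr_cons, satIn_all, ih, SatIn, not_exists, not_and]
  have h1 := satIn_exRange (U := U) (J := J) (v := v) (m := m) (k := k) (φ := neg φ)
  unfold exRange at h1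
  unfold allRange
  rw [key, h1]
  simp [SatIn]

end Formula

-- Simulating the insertion of one auxiliary fact

namespace Formula

variable {U : Set Const} {v : Var → Const}

/-- The bound `varBound ≤ m` prevents capture: no quantifier of `φ` rebinds a variable `x_{m+i}`, so
the inserted fact remains the same at every depth of the formula. -/
theorem satIn_insertAux {J : Set (Fact S.withAux)} {p : S.Pred} {m : ℕ} {φ : Formula S.withAux}
    (hφ : φ.varBound ≤ m) : (φ.insertAux p m).SatIn U J v ↔
      φ.SatIn U (insert (Fact.aux ⟨p, fun i => v (m + i)⟩) J) v := by
  induction φ generalizing v with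
  | fls => rfl
  | atom a =>
    obtain ⟨r | r, t⟩ := a
    · simp only [insertAux, SatIn, Set.mem_insert_iff]
      refine ⟨Or.inr, fun h => h.resolve_left fun h => ?_⟩
      have := congrArg Fact.pred h
      exact Sum.inl_ne_inr this
    · simp only [insertAux, satIn_or, SatIn, Set.mem_insert_iff]
      rw [or_comm]
      refine or_congr ?_ Iff.rfl
      split_ifs with hr
      · subst hr
        simp only [satIn_conj, List.mem_ofFn, forall_exists_index, forall_apply_eq_imp_iff, SatIn,
          Term.eval]
        constructor
        · intro h
          unfold Atom.inst Fact.aux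
          congr 1
          funext i
          exact h i
        · intro h i
          have h' := eq_of_heq (Fact.mk.inj h).2
          exact congrFun h' i
      · simp only [SatIn, false_iff]
        intro h
        have := congrArg Fact.pred h
        exact hr (Sum.inr_injective this)
  | eq s t => rfl
  | neg φ ih => simp only [insertAux, SatIn, ih hφ]
  | and φ ψ ih₁ ih₂ =>
    simp only [varBound, max_le_iff] at hφ
    simp only [insertAux, SatIn, ih₁ hφ.1, ih₂ hφ.2]
  | ex x φ ih =>
    simp only [varBound, max_le_iff] at hφ
    simp only [insertAux, SatIn, ih hφ.2]
    have : ∀ c, ∀ i : ℕ, Function.update v x c (m + i) = v (m + i) := fun c i =>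
      Function.update_of_ne (Nat.ne_of_gt (Nat.lt_of_lt_of_le hφ.1 (Nat.le_add_right m i))) _ _
    simp only [this]

end Formula

end RepairChecking

namespace RepairChecking

variable {S : Signature} {deps : List (Dependency S)} {D D' I : Set (Fact S)}

/-! ## Weak consistency and repairs -/

/-- All facts entailed by `D'` belong to `D`. -/
def WeaklyConsistent (deps : List (Dependency S)) (D D' : Set (Fact S)) : Prop :=
  ∀ f ∈ derivable deps D', f.pred ∈ predList deps → f ∈ D

/-- The `0`-ary fact `⊥`. -/
def botFact (S : Signature) : Fact S := ⟨S.bot, fun _ => 0⟩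

/-- Without a model, `⊥` is vacuously derivable, and weak consistency would put it into `D`. -/
theorem WeaklyConsistent.exists_isModel (h : WeaklyConsistent deps D D') (hD : IsDatabase D) :
    ∃ I, IsModel deps D' I := by
  by_contra hI
  simp only [not_exists] at hI
  exact hD.2 _ (h (botFact S) (fun I h => absurd h (hI I)) bot_mem_predList) rfl

/-- Maximality among consistent subsets can be tested by adding single facts, although the enlarged
set itself need not be consistent: its closure is, and weak consistency says that the closure still
fits inside `D`. -/
theorem isRepair_iff_weaklyConsistent (hfull : ∀ d ∈ deps, d.IsFull) (hD : IsDatabaseOver deps D)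
    (hD' : IsDatabaseOver deps D') : IsRepair deps D D' ↔ WeaklyConsistent deps D D' ∧
      ∀ f ∈ D, f ∉ D' → ¬ WeaklyConsistent deps D (insert f D') := by
  have hmodel : ∀ {X}, X ⊆ D → Consistent deps X → IsModel deps X X := fun hX hc =>
    ⟨subset_rfl, fun f hf => hD.1.2 f (hX hf), hc⟩
  have hsub : ∀ {X}, IsDatabaseOver deps X → WeaklyConsistent deps D X →
      derivable deps X ⊆ D ∧ IsModel deps X (derivable deps X) := by
    intro X hX hw
    obtain ⟨I, hI⟩ := hw.exists_isModel hD.1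
    exact ⟨fun f hf => hw f hf (pred_mem_of_mem_derivable hfull hI hX.2 hf),
      isModel_derivable hfull hI⟩
  have hins : ∀ {f}, f ∈ D → IsDatabaseOver deps (insert f D') := fun {f} hf =>
    ⟨⟨hD'.1.1.insert f, by
      rintro g (rfl | hg)
      exacts [hD.1.2 _ hf, hD'.1.2 _ hg]⟩, by
      rintro g (rfl | hg)
      exacts [hD.2 _ hf, hD'.2 _ hg]⟩
  constructor
  · rintro ⟨⟨hDD, hcons⟩, hmax⟩
    refine ⟨fun f hf _ => hDD (derivable_subset (hmodel hDD hcons) hf), fun f hf hfD' hw => ?_⟩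
    obtain ⟨h1, h2⟩ := hsub (hins hf) hw
    have h3 : D' ⊆ derivable deps (insert f D') :=
      (Set.subset_insert f D').trans subset_derivable
    exact hfD' (hmax ⟨h1, h2.2.2⟩ h3 (subset_derivable (Set.mem_insert f D')))
  · rintro ⟨hw, hmax⟩
    obtain ⟨h1, h2⟩ := hsub hD' hw
    -- Adding a derivable fact leaves the closure unchanged, hence preserves weak consistency; by
    -- the second condition `D'` is already closed.
    have hle : derivable deps D' ⊆ D' := by
      intro f hf
      by_contra hfD'
      refine hmax f (h1 hf) hfD' fun g hg _ => h1 ?_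
      refine hg _ ⟨Set.insert_subset hf subset_derivable, h2.2⟩
    have heq : derivable deps D' = D' := hle.antisymm subset_derivable
    rw [heq] at h1 h2
    refine ⟨⟨h1, h2.2.2⟩, fun Y hY hsubY => ?_⟩
    intro f hf
    by_contra hfD'
    -- A consistent `Y` between `D'` and `D` that contains `f` is a model of `insert f D'`, so the
    -- closure of the latter stays inside `Y`, hence inside `D`.
    refine hmax f (hY.1 hf) hfD' fun g hg _ => hY.1 (hg _ ⟨Set.insert_subset hf hsubY, ?_⟩)
    exact (hmodel hY.1 hY.2).2

/-! ## Syntax of the repair-checking sentence -/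

namespace Formula

theorem freeVars_conj (l : List (Formula S)) : (conj l).freeVars = ⋃ φ ∈ l, φ.freeVars := by
  induction l with
  | nil => simp [conj, tru, freeVars]
  | cons a l ih =>
    have : conj (a :: l) = and a (conj l) := rfl
    rw [this]
    simp [freeVars, ih]

theorem consts_conj (l : List (Formula S)) : (conj l).consts = ⋃ φ ∈ l, φ.consts := by
  induction l with
  | nil => simp [conj, tru, consts]
  | cons a l ih =>
    have : conj (a :: l) = and a (conj l) := rfl
    rw [this]
    simp [consts, ih]

theorem mem_freeVars_exRange {m k : ℕ} {φ : Formula S} {x : ℕ} :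
    x ∈ (exRange m k φ).freeVars ↔ x ∈ φ.freeVars ∧ ¬ (m ≤ x ∧ x < m + k) := by
  induction k generalizing φ with
  | zero => simp [exRange]
  | succ k ih =>
    have : exRange m (k + 1) φ = exRange m k (ex (m + k) φ) := by
      simp [exRange, List.range_succ]
    rw [this, ih]
    simp only [freeVars, Set.mem_sdiff, Set.mem_singleton_iff, and_assoc]
    refine and_congr_right fun _ => ?_
    omega

theorem mem_freeVars_allRange {m k : ℕ} {φ : Formula S} {x : ℕ} :
    x ∈ (allRange m k φ).freeVars ↔ x ∈ φ.freeVars ∧ ¬ (m ≤ x ∧ x < m + k) := by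
  induction k generalizing φ with
  | zero => simp [allRange]
  | succ k ih =>
    have : allRange m (k + 1) φ = allRange m k (all (m + k) φ) := by
      simp [allRange, List.range_succ]
    rw [this, ih]
    simp only [all, freeVars, Set.mem_sdiff, Set.mem_singleton_iff, and_assoc]
    refine and_congr_right fun _ => ?_
    omega

theorem consts_allRange (m k : ℕ) (φ : Formula S) : (allRange m k φ).consts = φ.consts := by
  unfold allRange
  induction List.range k with
  | nil => rfl
  | cons a l ih => simpa [all, consts] using ih

theorem freeVars_aux (φ : Formula S) : φ.aux.freeVars = φ.freeVars := by
  induction φ <;> simp_all [aux, freeVars]; rfl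

theorem consts_aux (φ : Formula S) : φ.aux.consts = φ.consts := by
  induction φ <;> simp_all [aux, consts]; rfl

theorem freeVars_insertAux_subset (p : S.Pred) (m : ℕ) (φ : Formula S.withAux) :
    (φ.insertAux p m).freeVars ⊆ φ.freeVars ∪ {x : ℕ | m ≤ x ∧ x < m + S.arity p} := by
  induction φ with
  | fls => simp [insertAux, freeVars]
  | atom a =>
    obtain ⟨r | r, t⟩ := a
    · exact Set.subset_union_left
    · simp only [insertAux, Formula.or, freeVars]
      refine Set.union_subset Set.subset_union_left ?_
      split_ifs with hr
      · subst hr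
        simp only [freeVars_conj, List.mem_ofFn, Set.iUnion_exists, Set.iUnion_iUnion_eq',
          Set.iUnion_subset_iff, freeVars, Set.union_subset_iff]
        intro i
        refine ⟨fun x hx => Or.inl (Set.mem_iUnion.2 ⟨i, hx⟩), ?_⟩
        rintro x rfl
        exact Or.inr ⟨Nat.le_add_right _ _, Nat.add_lt_add_left i.2 _⟩
      · simp [freeVars]
  | eq s t => exact Set.subset_union_left
  | neg φ ih => exact ih
  | and φ ψ ih₁ ih₂ =>
    simp only [insertAux, freeVars]
    rintro x (hx | hx)
    · exact (ih₁ hx).imp_left Or.inl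
    · exact (ih₂ hx).imp_left Or.inr
  | ex y φ ih =>
    simp only [insertAux, freeVars]
    rintro x ⟨hx, hxy⟩
    exact (ih hx).imp_left fun h => ⟨h, hxy⟩

end Formula

variable {R : S.Pred → Formula S}

theorem freeVars_atomic (p : S.Pred) :
    (CQ.atomic p).freeVars = {x : ℕ | x < S.arity p} := by
  ext (x : ℕ)
  simp only [CQ.freeVars, CQ.atomic, Conj.vars, Conj.atomVars, List.mem_singleton,
    exists_eq_left, Atom.vars, Term.vars, Set.mem_iUnion, Set.mem_singleton_iff]
  constructor
  · rintro ⟨⟨i, hi⟩ | h, -⟩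
    · rw [show x = _ from hi]; exact i.2
    · simp at h
  · exact fun h => ⟨Or.inl ⟨⟨x, h⟩, rfl⟩, by simp⟩

theorem freeVars_phiWc (hR : ∀ p ∈ predList deps, IsRewriting deps (CQ.atomic p) (R p)) :
    (phiWc deps R).freeVars = ∅ := by
  rw [phiWc, Formula.freeVars_conj, Set.eq_empty_iff_forall_notMem]
  intro (x : ℕ) hx
  simp only [List.mem_map, Set.iUnion_exists, Set.biUnion_and', Set.iUnion_iUnion_eq_right,
    Set.mem_iUnion] at hx
  obtain ⟨p, hp, hx⟩ := hx
  rw [phiWcPred] at hx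
  obtain ⟨hx, hlt⟩ := Formula.mem_freeVars_allRange.1 hx
  simp only [Formula.imp, Formula.freeVars, Formula.freeVars_aux] at hx
  refine hlt ⟨Nat.zero_le _, ?_⟩
  rw [Nat.zero_add]
  rcases hx with hx | hx
  · have := (hR p hp).1 hx
    rwa [freeVars_atomic] at this
  · obtain ⟨i, hi⟩ := Set.mem_iUnion.1 hx
    have hi' : x = 0 + (i : ℕ) := hi
    rw [hi', Nat.zero_add]
    exact i.2

theorem freeVars_phiRc (hR : ∀ p ∈ predList deps, IsRewriting deps (CQ.atomic p) (R p)) :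
    (phiRc deps R).freeVars = ∅ := by
  rw [phiRc]
  simp only [Formula.freeVars, freeVars_phiWc hR, Set.empty_union]
  rw [Formula.freeVars_conj, Set.eq_empty_iff_forall_notMem]
  intro (x : ℕ) hx
  simp only [List.mem_map, Set.iUnion_exists, Set.biUnion_and', Set.iUnion_iUnion_eq_right,
    Set.mem_iUnion] at hx
  obtain ⟨p, hp, hx⟩ := hx
  obtain ⟨hx, hlt⟩ := Formula.mem_freeVars_exRange.1 hx
  have hatom : ∀ m, x ∈ (varAtom p m).vars → m ≤ x ∧ x < m + S.arity p := by
    intro m h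
    obtain ⟨i, hi⟩ := Set.mem_iUnion.1 h
    have hi' : x = m + (i : ℕ) := hi
    rw [hi']
    exact ⟨Nat.le_add_right _ _, Nat.add_lt_add_left i.2 _⟩
  refine hlt ?_
  rcases hx with hx | hx | hx
  · exact hatom _ hx
  · exact hatom _ hx
  · rcases Formula.freeVars_insertAux_subset _ _ _ hx with h | h
    · rw [freeVars_phiWc hR] at h
      exact h.elim
    · exact h

theorem consts_subset_consts_phiRc {p : S.Pred} (hp : p ∈ predList deps) :
    (R p).consts ⊆ (phiRc deps R).consts := by
  rw [phiRc, Formula.consts, phiWc, Formula.consts_conj]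
  intro c hc
  refine Or.inl (Set.mem_biUnion (List.mem_map_of_mem hp) ?_)
  rw [phiWcPred, Formula.consts_allRange]
  exact Or.inl (by rwa [Formula.consts_aux])

/-! ## Correctness of the repair-checking sentence -/

/-- Each `R p` may be evaluated over `U` by its own domain independence. The outer universal
quantifiers lose nothing either, since the arguments of derivable facts lie in `U` whenever `D'` has
a model. -/
theorem satIn_phiWc (hfull : ∀ d ∈ deps, d.IsFull)
    (hR : ∀ p ∈ predList deps, IsRewriting deps (CQ.atomic p) (R p)) (hD : IsDatabase D)
    (hD' : IsDatabase D') {U : Set Const} (hU : U.Nonempty) (hUD' : adom D' ⊆ U)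
    (hUR : ∀ p ∈ predList deps, (R p).consts ⊆ U) (v : Var → Const) :
    (phiWc deps R).SatIn U (pairInstance D D') v ↔ WeaklyConsistent deps D D' := by
  have hpred : ∀ p ∈ predList deps, (phiWcPred R p).SatIn U (pairInstance D D') v ↔
      ∀ t : Fin (S.arity p) → Const, (∀ i, t i ∈ U) →
        (⟨p, t⟩ : Fact S) ∈ derivable deps D' → (⟨p, t⟩ : Fact S) ∈ D := by
    intro p hp
    rw [phiWcPred, Formula.satIn_allRange]
    refine forall_congr' fun t => forall_congr' fun ht => ?_
    have hval : ∀ i : Fin (S.arity p), Formula.assignRange 0 t v i = t i := fun i => by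
      have := Formula.assignRange_apply (v := v) 0 t i
      rwa [Nat.zero_add] at this
    rw [Formula.satIn_imp, Formula.satIn_aux]
    have h1 : (R p).SatIn U D' (Formula.assignRange 0 t v) ↔
        (⟨p, t⟩ : Fact S) ∈ derivable deps D' := by
      obtain ⟨hfree, hrew⟩ := hR p hp
      obtain ⟨hdi, hent⟩ := hrew D' hD'
      rw [hdi U _ hU hUD' (hUR p hp), ← hent, entails_atomic_iff]
      · simp only [hval]
      · intro (x : ℕ) hx
        have hx' := hfree hx
        rw [freeVars_atomic] at hx'
        exact (hval ⟨x, hx'⟩).symm ▸ ht _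
    have h2 : Formula.SatIn U (pairInstance D D') (Formula.assignRange 0 t v)
        (.atom (varAtom p 0).plain) ↔ (⟨p, t⟩ : Fact S) ∈ D := by
      have : (varAtom p 0).plain.inst (Formula.assignRange 0 t v) = Fact.plain ⟨p, t⟩ := by
        unfold Atom.inst Fact.plain
        congr 1
        funext i
        change Formula.assignRange 0 t v (0 + i) = t i
        exact Formula.assignRange_apply 0 t i
      rw [Formula.SatIn, this, plain_mem_pairInstance]
    rw [h1, h2]
  rw [phiWc, Formula.satIn_conj]
  simp only [List.mem_map, forall_exists_index, and_imp, forall_apply_eq_imp_iff₂]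
  constructor
  · intro h
    have h' := fun p hp => (hpred p hp).1 (h p hp)
    -- If there is no model, derivable facts have arbitrary arguments and may escape `U`; but then
    -- the instance for the nullary `⊥`, which no restriction of the quantifiers excludes, already
    -- contradicts that `D` is a database.
    by_cases hI : ∃ I, IsModel deps D' I
    · obtain ⟨I, hI⟩ := hI
      rintro ⟨p, t⟩ hf hp
      have hval : (⟨p, fun i => Formula.assignRange 0 t 0 i⟩ : Fact S) = ⟨p, t⟩ := by
        congr 1
        funext i
        have := Formula.assignRange_apply (v := 0) 0 t i
        rwa [Nat.zero_add] at this
      refine h' p hp t (fun i => ?_) hf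
      have := arg_mem_of_derivable hfull hD' hI (hR p hp) (hval ▸ hf) i
      have heq : Formula.assignRange 0 t 0 i = t i := by
        have := Formula.assignRange_apply (v := 0) 0 t i
        rwa [Nat.zero_add] at this
      rw [heq] at this
      exact this.elim (fun h => hUD' h) (fun h => hUR p hp h)
    · simp only [not_exists] at hI
      refine absurd rfl (hD.2 _ (h' S.bot bot_mem_predList (botFact S).args ?_ ?_))
      · intro i
        exact absurd i.2 (Nat.not_lt.2 (S.arity_bot.le.trans (Nat.zero_le _)))
      · exact fun I h => absurd h (hI I)
  · intro h p hp
    rw [hpred p hp]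
    exact fun t _ ht => h _ ht hp

/-- The right-hand side does not depend on `U`: taking all constants gives correctness, and
comparing with a smaller `U` gives domain independence. -/
theorem satIn_phiRc (hfull : ∀ d ∈ deps, d.IsFull)
    (hR : ∀ p ∈ predList deps, IsRewriting deps (CQ.atomic p) (R p))
    (hD : IsDatabaseOver deps D) (hD' : IsDatabaseOver deps D') {U : Set Const} (hU : U.Nonempty)
    (hUD : adom D ⊆ U) (hUD' : adom D' ⊆ U) (hUR : ∀ p ∈ predList deps, (R p).consts ⊆ U)
    (v : Var → Const) :
    (phiRc deps R).SatIn U (pairInstance D D') v ↔ IsRepair deps D D' := by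
  rw [isRepair_iff_weaklyConsistent hfull hD hD', phiRc]
  simp only [Formula.SatIn]
  rw [satIn_phiWc hfull hR hD.1 hD'.1 hU hUD' hUR, Formula.satIn_conj]
  simp only [List.mem_map, forall_exists_index, and_imp, forall_apply_eq_imp_iff₂, Formula.SatIn,
    Formula.satIn_exRange]
  refine and_congr_right fun _ => ?_
  generalize hm : (phiWc deps R).varBound = m
  have key : ∀ (p : S.Pred) (t : Fin (S.arity p) → Const),
      (((varAtom p m).plain.inst (Formula.assignRange m t v) ∈ pairInstance D D' ∧
        (varAtom p m).aux.inst (Formula.assignRange m t v) ∉ pairInstance D D' ∧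
        ((phiWc deps R).insertAux p m).SatIn U (pairInstance D D')
          (Formula.assignRange m t v)) ↔
      ((⟨p, t⟩ : Fact S) ∈ D ∧ (⟨p, t⟩ : Fact S) ∉ D' ∧
        WeaklyConsistent deps D (insert ⟨p, t⟩ D'))) := by
    intro p t
    have hval : (fun i : Fin (S.arity p) => Formula.assignRange m t v (m + i)) = t :=
      funext fun i => Formula.assignRange_apply m t i
    have h1 : (varAtom p m).plain.inst (Formula.assignRange m t v) = Fact.plain ⟨p, t⟩ := by
      unfold Atom.inst Fact.plain
      congr 1
    have h2 : (varAtom p m).aux.inst (Formula.assignRange m t v) = Fact.aux ⟨p, t⟩ := by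
      unfold Atom.inst Fact.aux
      congr 1
    rw [h1, h2, plain_mem_pairInstance, aux_mem_pairInstance,
      Formula.satIn_insertAux hm.le, hval, ← pairInstance_insert]
    refine and_congr_right fun hf => and_congr_right fun _ => ?_
    refine satIn_phiWc hfull hR hD.1 ⟨hD'.1.1.insert _, ?_⟩ hU ?_ hUR _
    · rintro g (rfl | hg)
      exacts [hD.1.2 _ hf, hD'.1.2 _ hg]
    · rintro c ⟨g, rfl | hg, hc⟩
      exacts [hUD ⟨_, hf, hc⟩, hUD' ⟨_, hg, hc⟩]
  simp only [key]
  constructor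
  · rintro h ⟨p, t⟩ hf hf' hw
    -- The restricted existential quantifiers find the fact to be added because it belongs to `D`,
    -- whose constants are in `U`.
    exact h p (hD.2 _ hf) ⟨t, fun i => hUD ⟨_, hf, i, rfl⟩, hf, hf', hw⟩
  · rintro h p - ⟨t, -, hf, hf', hw⟩
    exact h _ hf hf' hw

theorem isRepairRewriting_phiRc (hfull : ∀ d ∈ deps, d.IsFull)
    (hR : ∀ p ∈ predList deps, IsRewriting deps (CQ.atomic p) (R p)) :
    IsRepairRewriting deps (phiRc deps R) := by
  refine ⟨freeVars_phiRc hR, fun D D' hD hD' => ?_⟩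
  have hsat : ∀ v, (phiRc deps R).Sat (pairInstance D D') v ↔ IsRepair deps D D' :=
    satIn_phiRc hfull hR hD hD' Set.univ_nonempty (Set.subset_univ _) (Set.subset_univ _)
      fun _ _ => Set.subset_univ _
  refine ⟨fun U v hU hadom hconsts _ => ?_, hsat⟩
  rw [hsat]
  rw [adom_pairInstance, Set.union_subset_iff] at hadom
  exact satIn_phiRc hfull hR hD hD' hU hadom.1 hadom.2
    (fun p hp => (consts_subset_consts_phiRc hp).trans hconsts) v

end RepairChecking

namespace RepairChecking

/-! ## Templates of circuit families

A template describes a circuit for every valuation of finitely many registers; register `0`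
holds the input length `n`. Below `d` quantified loops the loop variable is register `d`. -/

inductive Template where
  | input (e : Expr)
  | tru
  | not (t : Template)
  | and (t u : Template)
  | all (t : Template)
  | ite (e : Expr) (t u : Template)

namespace Template

/-- The circuit described by a template. -/
def expand : ℕ → (ℕ → ℕ) → Template → Circuit
  | _, s, input e => .input (e.eval s)
  | _, _, tru => .and []
  | d, s, not t => .not (expand d s t)
  | d, s, and t u => .and [expand d s t, expand d s u]
  | d, s, all t => .and ((List.range (s 0)).map fun i => expand (d + 1) (Function.update s d i) t)
  | d, s, ite e t u => if e.eval s ≠ 0 then expand d s t else expand d s u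

/-- The truth value of the circuit described by a template. -/
def Holds (W : List Bool) : ℕ → (ℕ → ℕ) → Template → Prop
  | _, s, input e => W.getD (e.eval s) false = true
  | _, _, tru => True
  | d, s, not t => ¬ Holds W d s t
  | d, s, and t u => Holds W d s t ∧ Holds W d s u
  | d, s, all t => ∀ i < s 0, Holds W (d + 1) (Function.update s d i) t
  | d, s, ite e t u => if e.eval s ≠ 0 then Holds W d s t else Holds W d s u

/-- A program that prints the circuit described by a template. -/
def compile : ℕ → Template → Prog
  | _, input e => .seq (.emit (.const 0)) (.emit e)
  | _, tru => .seq (.emit (.const 2)) (.emit (.const 4))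
  | d, not t => .seq (.emit (.const 1)) (compile d t)
  | d, and t u =>
      .seq (.emit (.const 2)) (.seq (compile d t) (.seq (compile d u) (.emit (.const 4))))
  | d, all t =>
      .seq (.emit (.const 2)) (.seq
        (.while (.sub (.reg 0) (.reg d))
          (.seq (compile (d + 1) t) (.assign d (.add (.reg d) (.const 1)))))
        (.seq (.assign d (.const 0)) (.emit (.const 4))))
  | d, ite e t u => .ite e (compile d t) (compile d u)

end Template

-- Value, depth, size and printing of expanded templates

theorem Circuit.evalAnd_eq_true_iff (W : List Bool) (cs : List Circuit) :
    evalAnd W cs = true ↔ ∀ c ∈ cs, c.eval W = true := by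
  induction cs with
  | nil => simp [evalAnd]
  | cons c cs ih => simp [evalAnd, ih]

theorem Circuit.sizeList_le {cs : List Circuit} {b : ℕ} (h : ∀ c ∈ cs, c.size ≤ b) :
    sizeList cs ≤ cs.length * b := by
  induction cs with
  | nil => simp [sizeList]
  | cons c cs ih =>
    simp only [List.mem_cons, forall_eq_or_imp] at h
    have := ih h.2
    simp only [sizeList, List.length_cons, Nat.add_mul]
    omega

theorem Circuit.depthList_le {cs : List Circuit} {b : ℕ} (h : ∀ c ∈ cs, c.depth ≤ b) :
    depthList cs ≤ b := by
  induction cs with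
  | nil => simp [depthList]
  | cons c cs ih =>
    simp only [List.mem_cons, forall_eq_or_imp] at h
    exact max_le h.1 (ih h.2)

namespace Template

theorem eval_expand (W : List Bool) (d : ℕ) (s : ℕ → ℕ) (t : Template) :
    (t.expand d s).eval W = true ↔ t.Holds W d s := by
  induction t generalizing d s with
  | input e => rfl
  | tru => simp [expand, Circuit.eval, Circuit.evalAnd, Holds]
  | not t ih => simp [expand, Circuit.eval, Holds, ← ih]
  | and t u iht ihu => simp [expand, Circuit.eval, Circuit.evalAnd_eq_true_iff, Holds, iht, ihu]
  | all t ih => simp [expand, Circuit.eval, Circuit.evalAnd_eq_true_iff, Holds, ih]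
  | ite e t u iht ihu =>
    simp only [expand, Holds]
    split_ifs
    exacts [iht d s, ihu d s]

theorem exists_depth_le (t : Template) : ∃ b, ∀ d s, (t.expand d s).depth ≤ b := by
  induction t with
  | input e => exact ⟨0, fun d s => le_rfl⟩
  | tru => exact ⟨1, fun d s => le_rfl⟩
  | not t ih =>
    obtain ⟨b, hb⟩ := ih
    exact ⟨b + 1, fun d s => Nat.succ_le_succ (hb d s)⟩
  | and t u iht ihu =>
    obtain ⟨b, hb⟩ := iht
    obtain ⟨c, hc⟩ := ihu
    refine ⟨max b c + 1, fun d s => Nat.succ_le_succ (Circuit.depthList_le ?_)⟩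
    simp only [List.mem_cons, List.not_mem_nil, or_false, forall_eq_or_imp, forall_eq]
    exact ⟨(hb d s).trans (le_max_left _ _), (hc d s).trans (le_max_right _ _)⟩
  | all t ih =>
    obtain ⟨b, hb⟩ := ih
    refine ⟨b + 1, fun d s => Nat.succ_le_succ (Circuit.depthList_le ?_)⟩
    simp only [List.mem_map, forall_exists_index, and_imp, forall_apply_eq_imp_iff₂]
    exact fun i _ => hb _ _
  | ite e t u iht ihu =>
    obtain ⟨b, hb⟩ := iht
    obtain ⟨c, hc⟩ := ihu
    refine ⟨max b c, fun d s => ?_⟩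
    simp only [expand]
    split_ifs
    exacts [(hb d s).trans (le_max_left _ _), (hc d s).trans (le_max_right _ _)]

/-- A loop multiplies the size by at most `n`, which raises the exponent by one; the same number
serves as coefficient and exponent. The condition `0 < d` ensures that loop variables never
overwrite register `0`, which holds `n`. -/
theorem exists_size_le (t : Template) :
    ∃ b, ∀ d s, 0 < d → (t.expand d s).size ≤ b * (s 0 + 1) ^ b := by
  have hmono : ∀ {b c n : ℕ}, b ≤ c → b * (n + 1) ^ b ≤ c * (n + 1) ^ c := fun h =>
    Nat.mul_le_mul h (Nat.pow_le_pow_right (Nat.succ_pos _) h)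
  have hone : ∀ (b n : ℕ), 1 ≤ (n + 1) ^ b := fun b n => Nat.one_le_pow _ _ (Nat.succ_pos _)
  induction t with
  | input e => exact ⟨1, fun d s _ => by simp [expand, Circuit.size]⟩
  | tru => exact ⟨1, fun d s _ => by simp [expand, Circuit.size, Circuit.sizeList]⟩
  | not t ih =>
    obtain ⟨b, hb⟩ := ih
    refine ⟨b + 1, fun d s hd => ?_⟩
    have h1 := hb d s hd
    have h2 : b * (s 0 + 1) ^ b ≤ b * (s 0 + 1) ^ (b + 1) :=
      Nat.mul_le_mul_left _ (Nat.pow_le_pow_right (Nat.succ_pos _) (Nat.le_succ _))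
    have h3 := hone (b + 1) (s 0)
    simp only [expand, Circuit.size, Nat.add_mul]
    omega
  | and t u iht ihu =>
    obtain ⟨b, hb⟩ := iht
    obtain ⟨c, hc⟩ := ihu
    refine ⟨b + c + 1, fun d s hd => ?_⟩
    have h1 := hb d s hd
    have h2 := hc d s hd
    have h3 : b * (s 0 + 1) ^ b ≤ b * (s 0 + 1) ^ (b + c + 1) :=
      Nat.mul_le_mul_left _ (Nat.pow_le_pow_right (Nat.succ_pos _) (by omega))
    have h4 : c * (s 0 + 1) ^ c ≤ c * (s 0 + 1) ^ (b + c + 1) :=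
      Nat.mul_le_mul_left _ (Nat.pow_le_pow_right (Nat.succ_pos _) (by omega))
    have h5 := hone (b + c + 1) (s 0)
    simp only [expand, Circuit.size, Circuit.sizeList, Nat.add_mul]
    omega
  | all t ih =>
    obtain ⟨b, hb⟩ := ih
    refine ⟨b + 1, fun d s hd => ?_⟩
    have h1 : Circuit.sizeList ((List.range (s 0)).map fun i =>
        expand (d + 1) (Function.update s d i) t) ≤ s 0 * (b * (s 0 + 1) ^ b) := by
      refine (Circuit.sizeList_le (b := b * (s 0 + 1) ^ b) ?_).trans (by simp)
      simp only [List.mem_map, forall_exists_index, and_imp, forall_apply_eq_imp_iff₂]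
      intro i _
      have := hb (d + 1) (Function.update s d i) (Nat.succ_pos d)
      rwa [Function.update_of_ne hd.ne] at this
    have h2 : s 0 * (b * (s 0 + 1) ^ b) ≤ b * (s 0 + 1) ^ (b + 1) := by
      rw [pow_succ]
      nlinarith [Nat.zero_le (b * (s 0 + 1) ^ b)]
    have h3 := hone (b + 1) (s 0)
    simp only [expand, Circuit.size, Nat.add_mul]
    omega
  | ite e t u iht ihu =>
    obtain ⟨b, hb⟩ := iht
    obtain ⟨c, hc⟩ := ihu
    refine ⟨max b c, fun d s hd => ?_⟩
    simp only [expand]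
    split_ifs
    exacts [(hb d s hd).trans (hmono (le_max_left _ _)),
      (hc d s hd).trans (hmono (le_max_right _ _))]

/-- The invariant is that all registers from `d` on are zero before and after; this is why a loop
resets its register on exit. Only loop counters are ever stored, and they are at most `n`; input
positions are emitted without being stored. -/
theorem run_compile (t : Template) (d : ℕ) (hd : 0 < d) (s : ℕ → ℕ) (hs : ∀ r, d ≤ r → s r = 0) :
    Run (Nat.log 2 (s 0) + 1) (t.compile d) s (t.expand d s).code s := by
  have hemit : ∀ {b : ℕ} (k : ℕ) (s : ℕ → ℕ), Run b (.emit (.const k)) s [k] s :=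
    fun k s => Run.emit (.const k) s
  induction t generalizing d s with
  | input e => exact Run.seq (hemit 0 s) (Run.emit e s)
  | tru => exact Run.seq (hemit 2 s) (hemit 4 s)
  | not t ih => exact Run.seq (hemit 1 s) (ih d hd s hs)
  | and t u iht ihu =>
    have := Run.seq (hemit 2 s) (Run.seq (iht d hd s hs) (Run.seq (ihu d hd s hs) (hemit 4 s)))
    simpa [compile, expand, Circuit.code, Circuit.codeList] using this
  | all t ih =>
    have hsize : ∀ k ≤ s 0, Nat.size k ≤ Nat.log 2 (s 0) + 1 := by
      intro k hk
      exact Nat.size_le.2 (hk.trans_lt (Nat.lt_pow_succ_log_self Nat.one_lt_two _))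
    -- Here `i` is the current counter and `k` the number of iterations left.
    have hloop : ∀ k i, i + k = s 0 →
        Run (Nat.log 2 (s 0) + 1)
          (.while (.sub (.reg 0) (.reg d))
            (.seq (compile (d + 1) t) (.assign d (.add (.reg d) (.const 1)))))
          (Function.update s d i)
          (Circuit.codeList ((List.range' i k).map fun i =>
            expand (d + 1) (Function.update s d i) t))
          (Function.update s d (s 0)) := by
      intro k
      induction k with
      | zero =>
        intro i hi
        obtain rfl : i = s 0 := hi
        refine Run.while_false ?_
        simp [Expr.eval, Function.update_of_ne hd.ne]
      | succ k ihk =>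
        intro i hi
        have h1 := ih (d + 1) (Nat.succ_pos d) (Function.update s d i) fun r hr => by
          rw [Function.update_of_ne (by omega)]
          exact hs r (by omega)
        rw [Function.update_of_ne hd.ne] at h1
        have h2 : Run (Nat.log 2 (s 0) + 1) (.assign d (.add (.reg d) (.const 1)))
            (Function.update s d i) [] (Function.update s d (i + 1)) := by
          have := Run.assign (b := Nat.log 2 (s 0) + 1) d (.add (.reg d) (.const 1))
            (Function.update s d i) (by
              simp only [Expr.eval, Function.update_self]
              exact hsize _ (by omega))
          simpa [Expr.eval] using this
        have h3 := Run.while_true (e := .sub (.reg 0) (.reg d)) ?_ (Run.seq h1 h2)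
          (ihk (i + 1) (by omega))
        · simpa [List.range'_succ, Circuit.codeList] using h3
        · simp only [Expr.eval, Function.update_self, Function.update_of_ne hd.ne]
          omega
    have h0 := hloop (s 0) 0 (Nat.zero_add _)
    rw [show Function.update s d 0 = s from by
      rw [← hs d le_rfl]; exact Function.update_eq_self d s] at h0
    have hreset : Run (Nat.log 2 (s 0) + 1) (.assign d (.const 0)) (Function.update s d (s 0)) []
        s := by
      have := Run.assign (b := Nat.log 2 (s 0) + 1) d (.const 0) (Function.update s d (s 0))
        (by simp [Expr.eval])
      simp only [Expr.eval, Function.update_idem] at this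
      rwa [show Function.update s d 0 = s from by
        rw [← hs d le_rfl]; exact Function.update_eq_self d s] at this
    have := Run.seq (hemit 2 s) (Run.seq h0 (Run.seq hreset (hemit 4 s)))
    simpa [compile, expand, Circuit.code, List.range_eq_range'] using this
  | ite e t u iht ihu =>
    simp only [expand, compile]
    split_ifs with h
    exacts [Run.ite_true h (iht d hd s hs), Run.ite_false (not_not.1 h) (ihu d hd s hs)]

end Template

/-- A language decided by the circuits described by a template is in AC⁰. -/
theorem inAC0_of_template {L : Set (List Bool)} (t : Template)
    (h : ∀ W : List Bool, W ∈ L ↔ t.Holds W 1 (Function.update (fun _ => 0) 0 W.length)) :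
    InAC0 L := by
  refine ⟨fun n => t.expand 1 (Function.update (fun _ => 0) 0 n), ?_, ?_, ?_, fun W => ?_⟩
  · obtain ⟨b, hb⟩ := t.exists_size_le
    exact ⟨b, fun n => by simpa using hb 1 (Function.update (fun _ => 0) 0 n) one_pos⟩
  · obtain ⟨b, hb⟩ := t.exists_depth_le
    exact ⟨b, fun n => hb _ _⟩
  · refine ⟨t.compile 1, 1, fun n => ⟨Function.update (fun _ => 0) 0 n, ?_⟩⟩
    have := t.run_compile 1 one_pos (Function.update (fun _ => 0) 0 n) fun r hr => by
      rw [Function.update_of_ne (by omega)]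
    rw [one_mul]
    simpa using this
  · rw [h, Template.eval_expand]

end RepairChecking

namespace RepairChecking

variable {S : Signature} {deps : List (Dependency S)}

/-! ## Reading encoded databases -/

/-- The number written in binary in the `w` letters of `W` that start at position `a`. -/
def wordValue (W : List Bool) (w a : ℕ) : ℕ := Nat.ofBits fun j : Fin w => W.getD (a + j) false

theorem wordValue_lt (W : List Bool) (w a : ℕ) : wordValue W w a < 2 ^ w :=
  Nat.ofBits_lt_two_pow _

theorem testBit_wordValue {W : List Bool} {w a j : ℕ} :
    (wordValue W w a).testBit j = true ↔ j < w ∧ W.getD (a + j) false = true := by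
  rw [wordValue, Nat.testBit_ofBits]
  split_ifs with h <;> simp [h]

theorem testBit_wordValue_of_lt {W : List Bool} {w a j : ℕ} (h : j < w) :
    (wordValue W w a).testBit j = W.getD (a + j) false := by
  rw [wordValue, Nat.testBit_ofBits, dif_pos h]

theorem wordValue_eq_iff {W : List Bool} {w a c : ℕ} (hc : c < 2 ^ w) :
    wordValue W w a = c ↔ ∀ j < w, W.getD (a + j) false = c.testBit j := by
  constructor
  · rintro rfl j hj
    exact (testBit_wordValue_of_lt hj).symm
  · intro h
    refine Nat.eq_of_testBit_eq fun j => ?_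
    by_cases hj : j < w
    · rw [testBit_wordValue_of_lt hj, h j hj]
    · have hle : 2 ^ w ≤ 2 ^ j := Nat.pow_le_pow_right two_pos (Nat.not_lt.1 hj)
      rw [Nat.testBit_lt_two_pow ((wordValue_lt W w a).trans_le hle),
        Nat.testBit_lt_two_pow (hc.trans_le hle)]

theorem getD_flatMap_of_length_eq {α β : Type*} {l : List α} {f : α → List β} {L : ℕ} (b : β)
    (hL : ∀ x ∈ l, (f x).length = L) {j i : ℕ} (hj : j < l.length) (hi : i < L) :
    (l.flatMap f).getD (j * L + i) b = (f l[j]).getD i b := by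
  induction l generalizing j with
  | nil => simp at hj
  | cons x l ih =>
    simp only [List.mem_cons, forall_eq_or_imp] at hL
    rw [List.flatMap_cons]
    cases j with
    | zero => rw [Nat.zero_mul, Nat.zero_add, List.getD_append _ _ _ _ (by omega)]; rfl
    | succ j =>
      rw [List.getD_append_right _ _ _ _ (by rw [hL.1, Nat.add_mul]; omega), hL.1,
        show (j + 1) * L + i - L = j * L + i by rw [Nat.add_mul]; omega,
        ih hL.2 (by simpa using hj)]
      rfl

theorem length_flatMap_of_length_eq {α β : Type*} {l : List α} {f : α → List β} {L : ℕ}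
    (hL : ∀ x ∈ l, (f x).length = L) : (l.flatMap f).length = l.length * L := by
  induction l with
  | nil => simp
  | cons x l ih =>
    simp only [List.mem_cons, forall_eq_or_imp] at hL
    rw [List.flatMap_cons, List.length_append, hL.1, ih hL.2, List.length_cons, Nat.add_mul]
    omega

theorem eq_of_getD_eq {α : Type*} {l l' : List α} (b : α) (hlen : l.length = l'.length)
    (h : ∀ i < l.length, l.getD i b = l'.getD i b) : l = l' := by
  refine List.ext_getElem hlen fun i h1 h2 => ?_
  have := h i h1
  rwa [List.getD_eq_getElem _ _ h1, List.getD_eq_getElem _ _ h2] at this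

/-- The length of the encoding of a fact. -/
def recordLength (deps : List (Dependency S)) (w : ℕ) : ℕ :=
  1 + (predList deps).length + maxArity deps * w

theorem recordLength_pos (w : ℕ) : 0 < recordLength deps w := by
  unfold recordLength; omega

theorem length_bits (w c : ℕ) : (bits w c).length = w := by simp [bits]

theorem length_encodeRecord (w : ℕ) (e : Bool × Fact S) :
    (encodeRecord deps w e).length = recordLength deps w := by
  rw [encodeRecord, List.length_cons, List.length_append,
    length_flatMap_of_length_eq (L := w) fun _ _ => length_bits _ _]
  simp [recordLength]
  omega

theorem le_foldr_max {l : List ℕ} {x : ℕ} (h : x ∈ l) : x ≤ l.foldr max 0 := by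
  induction l with
  | nil => simp at h
  | cons a l ih =>
    rcases List.mem_cons.1 h with rfl | h
    · exact le_max_left _ _
    · exact (ih h).trans (le_max_right _ _)

theorem arity_le_maxArity {p : S.Pred} (hp : p ∈ predList deps) :
    S.arity p ≤ maxArity deps := le_foldr_max (List.mem_map_of_mem hp)

/-- The encoding of the fact `e` is found in `W` at position `a`. -/
def RecordAt (deps : List (Dependency S)) (W : List Bool) (w a : ℕ) (e : Bool × Fact S) : Prop :=
  ∀ i < recordLength deps w, W.getD (a + i) false = (encodeRecord deps w e).getD i false

theorem Fact.argD_lt {f : Fact S} {w : ℕ} (h : ∀ i, f.args i < 2 ^ w) (i : ℕ) :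
    f.argD i < 2 ^ w := by
  unfold Fact.argD
  split_ifs
  exacts [h _, Nat.two_pow_pos w]

/-- Splits a bitwise match into the database mark, the one-hot code of the predicate, and one number
per argument slot. The bound on the arguments makes a comparison of `w` bits equivalent to equality
of numbers. -/
theorem recordAt_iff {W : List Bool} {w a : ℕ} {e : Bool × Fact S}
    (he : ∀ i, e.2.args i < 2 ^ w) : RecordAt deps W w a e ↔ W.getD a false = e.1 ∧
      (∀ k, ∀ hk : k < (predList deps).length,
        W.getD (a + 1 + k) false = decide (e.2.pred = (predList deps)[k])) ∧
      ∀ i < maxArity deps,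
        wordValue W w (a + 1 + (predList deps).length + i * w) = e.2.argD i := by
  have hpart : ∀ k, ∀ hk : k < (predList deps).length,
      (encodeRecord deps w e).getD (1 + k) false = decide (e.2.pred = (predList deps)[k]) := by
    intro k hk
    rw [encodeRecord, Nat.add_comm, List.getD_cons_succ, List.getD_append _ _ _ _ (by simpa),
      List.getD_eq_getElem _ _ (by simpa), List.getElem_map]
  have harg : ∀ i < maxArity deps, ∀ j < w,
      (encodeRecord deps w e).getD (1 + (predList deps).length + (i * w + j)) false =
        (e.2.argD i).testBit j := by
    intro i hi j hj
    rw [encodeRecord, Nat.add_assoc, Nat.add_comm 1, List.getD_cons_succ,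
      List.getD_append_right _ _ _ _ (by simp), List.length_map, Nat.add_sub_cancel_left,
      getD_flatMap_of_length_eq false (fun _ _ => length_bits _ _) (by simpa) hj]
    simp [bits, hj]
  constructor
  · intro h
    refine ⟨h 0 (recordLength_pos w), fun k hk => ?_, fun i hi => ?_⟩
    · rw [← hpart k hk, ← h (1 + k) (by unfold recordLength; omega), Nat.add_assoc]
    · rw [wordValue_eq_iff (Fact.argD_lt he i)]
      intro j hj
      have hlt : i * w + j < maxArity deps * w := by
        calc i * w + j < (i + 1) * w := by rw [Nat.add_mul]; omega
          _ ≤ _ := Nat.mul_le_mul_right w hi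
      rw [← harg i hi j hj, ← h _ (by unfold recordLength; omega)]
      congr 1
      omega
  · rintro ⟨h1, h2, h3⟩ r hr
    rcases Nat.eq_zero_or_pos r with rfl | hpos
    · exact h1
    by_cases hr1 : r - 1 < (predList deps).length
    · obtain ⟨k, rfl⟩ : ∃ k, r = 1 + k := ⟨r - 1, by omega⟩
      rw [hpart k (by omega), ← h2 k (by omega), Nat.add_assoc]
    · obtain ⟨k, rfl⟩ : ∃ k, r = 1 + (predList deps).length + k :=
        ⟨r - 1 - (predList deps).length, by omega⟩
      have hk : k < maxArity deps * w := by unfold recordLength at hr; omega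
      have hw : 0 < w := Nat.pos_of_ne_zero fun h0 => by simp [h0] at hk
      have hi : k / w < maxArity deps := (Nat.div_lt_iff_lt_mul hw).2 hk
      have hk' : k / w * w + k % w = k := Nat.div_add_mod' k w
      have := (wordValue_eq_iff (Fact.argD_lt he _)).1 (h3 (k / w) hi) (k % w) (Nat.mod_lt _ hw)
      rw [← harg _ hi _ (Nat.mod_lt _ hw), hk'] at this
      rw [← this]
      congr 1
      omega

/-- All records have the same length, so being an encoding is a condition on the letters at
positions given by arithmetic in `w` and the record index. This is the form that templates can test.
-/
theorem eq_encode_iff {W : List Bool} {w : ℕ} {es : List (Bool × Fact S)} :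
    W = encode deps w es ↔ W.length = w + 1 + es.length * recordLength deps w ∧
      (∀ j < w, W.getD j false = true) ∧ W.getD w false = false ∧
      ∀ j, ∀ hj : j < es.length,
        RecordAt deps W w (w + 1 + j * recordLength deps w) es[j] := by
  have hlen : (encode deps w es).length = w + 1 + es.length * recordLength deps w := by
    rw [encode, List.length_append, List.length_cons,
      length_flatMap_of_length_eq fun _ _ => length_encodeRecord w _, List.length_replicate]
    omega
  have h1 : ∀ j < w, (encode deps w es).getD j false = true := by
    intro j hj
    rw [encode, List.getD_append _ _ _ _ (by simpa)]
    simp [hj]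
  have h2 : (encode deps w es).getD w false = false := by
    rw [encode, List.getD_append_right _ _ _ _ (by simp)]
    simp
  have h3 : ∀ k, (encode deps w es).getD (w + 1 + k) false =
      (es.flatMap (encodeRecord deps w)).getD k false := by
    intro k
    rw [encode, List.getD_append_right _ _ _ _ (by simp; omega), List.length_replicate,
      show w + 1 + k - w = k + 1 by omega, List.getD_cons_succ]
  have h4 : ∀ j, ∀ hj : j < es.length, ∀ i < recordLength deps w,
      (encode deps w es).getD (w + 1 + j * recordLength deps w + i) false =
        (encodeRecord deps w es[j]).getD i false := by
    intro j hj i hi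
    rw [Nat.add_assoc, h3,
      getD_flatMap_of_length_eq false (fun _ _ => length_encodeRecord w _) hj hi]
  constructor
  · rintro rfl
    exact ⟨hlen, h1, h2, h4⟩
  · rintro ⟨g0, g1, g2, g3⟩
    refine eq_of_getD_eq false (g0.trans hlen.symm) fun i hi => ?_
    rcases lt_trichotomy i w with h | rfl | h
    · rw [g1 i h, h1 i h]
    · rw [g2, h2]
    · obtain ⟨k, rfl⟩ : ∃ k, i = w + 1 + k := ⟨i - w - 1, by omega⟩
      have hk : k < es.length * recordLength deps w := by omega
      have hj : k / recordLength deps w < es.length :=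
        (Nat.div_lt_iff_lt_mul (recordLength_pos w)).2 hk
      have hr := Nat.mod_lt k (recordLength_pos (deps := deps) w)
      have := (g3 _ hj _ hr).trans (h4 _ hj _ hr).symm
      rwa [Nat.add_assoc, Nat.div_add_mod'] at this

end RepairChecking

namespace RepairChecking

/-! ## Derived templates -/

/-- All registers of the expression lie below `d`. -/
def Expr.Below (d : ℕ) : Expr → Prop
  | const _ => True
  | reg r => r < d
  | add e f => e.Below d ∧ f.Below d
  | sub e f => e.Below d ∧ f.Below d
  | mul e f => e.Below d ∧ f.Below d

theorem Expr.Below.eval_update {d : ℕ} {e : Expr} (h : e.Below d) (s : ℕ → ℕ) (i : ℕ) :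
    e.eval (Function.update s d i) = e.eval s := by
  induction e with
  | const k => rfl
  | reg r => exact Function.update_of_ne (Nat.ne_of_lt h) _ _
  | add e f ihe ihf => simp only [eval, ihe h.1, ihf h.2]
  | sub e f ihe ihf => simp only [eval, ihe h.1, ihf h.2]
  | mul e f ihe ihf => simp only [eval, ihe h.1, ihf h.2]

theorem Expr.Below.mono {d d' : ℕ} {e : Expr} (h : e.Below d) (hd : d ≤ d') : e.Below d' := by
  induction e with
  | const k => trivial
  | reg r => exact Nat.lt_of_lt_of_le h hd
  | add e f ihe ihf => exact ⟨ihe h.1, ihf h.2⟩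
  | sub e f ihe ihf => exact ⟨ihe h.1, ihf h.2⟩
  | mul e f ihe ihf => exact ⟨ihe h.1, ihf h.2⟩

namespace Template

def fls : Template := .not tru

def or (t u : Template) : Template := .not (.and (.not t) (.not u))

def iff (t u : Template) : Template := .and (.or (.not t) u) (.or (.not u) t)

def ex (t : Template) : Template := .not (.all (.not t))

/-- Conjunction of a list of templates. -/
def conj (l : List Template) : Template := l.foldr and tru

/-- Disjunction of a list of templates. -/
def disj (l : List Template) : Template := l.foldr or fls

/-- The comparison `e < f` of two numbers. -/
def lt (e f : Expr) : Template := ite (.sub f e) tru fls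

/-- The comparison `e = f` of two numbers. -/
def eq (e f : Expr) : Template := ite (.add (.sub e f) (.sub f e)) fls tru

/-- The input letter number `e` equals `b`. -/
def lit (b : Bool) (e : Expr) : Template := if b then input e else .not (input e)

variable {W : List Bool} {d : ℕ} {s : ℕ → ℕ} {t u : Template} {l : List Template} {e f : Expr}

theorem holds_fls : ¬ fls.Holds W d s := by simp [fls, Holds]

theorem holds_or : (Template.or t u).Holds W d s ↔ t.Holds W d s ∨ u.Holds W d s := by
  simp only [Template.or, Holds]; tauto

theorem holds_iff : (Template.iff t u).Holds W d s ↔ (t.Holds W d s ↔ u.Holds W d s) := by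
  simp only [Template.iff, Holds, holds_or]; tauto

theorem holds_ex :
    (ex t).Holds W d s ↔ ∃ i < s 0, t.Holds W (d + 1) (Function.update s d i) := by
  simp [ex, Holds]

theorem holds_conj : (conj l).Holds W d s ↔ ∀ t ∈ l, t.Holds W d s := by
  induction l with
  | nil => simp [conj, Holds]
  | cons a l ih =>
    simp only [conj, List.foldr_cons, Holds, List.mem_cons, forall_eq_or_imp] at ih ⊢
    rw [ih]

theorem holds_disj : (disj l).Holds W d s ↔ ∃ t ∈ l, t.Holds W d s := by
  induction l with
  | nil => simp [disj, holds_fls]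
  | cons a l ih =>
    simp only [disj, List.foldr_cons, holds_or, List.mem_cons, exists_eq_or_imp] at ih ⊢
    rw [ih]

theorem holds_lt : (lt e f).Holds W d s ↔ e.eval s < f.eval s := by
  rw [lt, Holds, Expr.eval]
  split_ifs with h
  · simp only [Holds, true_iff]; omega
  · simp only [holds_fls, false_iff]; omega

theorem holds_eq : (eq e f).Holds W d s ↔ e.eval s = f.eval s := by
  rw [eq, Holds, Expr.eval, Expr.eval, Expr.eval]
  split_ifs with h
  · simp only [holds_fls, false_iff]; omega
  · simp only [Holds, true_iff]; omega

theorem holds_lit {b : Bool} :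
    (lit b e).Holds W d s ↔ W.getD (e.eval s) false = b := by
  cases b <;> simp [lit, Holds]

end Template

/-! ## Templates for the elements of the domain -/

/-- A description of a constant: either the number written in the input at a position, or a
fixed number. -/
inductive Elem where
  | pos (e : Expr)
  | const (c : Const)

namespace Elem

/-- The constant described; register `1` holds the number of bits of the constants. -/
def value (W : List Bool) (s : ℕ → ℕ) : Elem → Const
  | pos e => wordValue W (s 1) (e.eval s)
  | const c => c

def Below (d : ℕ) : Elem → Prop
  | pos e => e.Below d
  | const _ => True

/-- The value of a bit of the constant described. -/
def bit (j : Expr) : Elem → Template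
  | pos e => .ite (.sub (.reg 1) j) (.input (.add e j)) .fls
  | const c => .disj (((List.range c).filter fun k => c.testBit k).map fun k =>
      .eq j (.const k))

/-- A bound on the number of bits of a fixed constant. -/
def bitBound : Elem → ℕ
  | pos _ => 0
  | const c => c

/-- Equality of the constants described. -/
def eq (d : ℕ) (x y : Elem) : Template :=
  .and (.all (.iff (x.bit (.reg d)) (y.bit (.reg d))))
    (.conj ((List.range (max x.bitBound y.bitBound)).map fun k =>
      .iff (x.bit (.const k)) (y.bit (.const k))))

variable {W : List Bool} {d : ℕ} {s : ℕ → ℕ} {x y : Elem}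

theorem Below.value_update (h : x.Below d) (hd : 1 < d) (s : ℕ → ℕ) (i : ℕ) :
    x.value W (Function.update s d i) = x.value W s := by
  cases x with
  | pos e =>
    have he : e.Below d := h
    simp only [value, he.eval_update, Function.update_of_ne hd.ne]
  | const c => rfl

theorem Below.mono {d' : ℕ} (h : x.Below d) (hd : d ≤ d') : x.Below d' := by
  cases x with
  | pos e => exact Expr.Below.mono h hd
  | const c => trivial

theorem testBit_const_imp_lt {c k : ℕ} (h : c.testBit k = true) : k < c := by
  by_contra hk
  have := Nat.testBit_lt_two_pow
    (c.lt_two_pow_self.trans_le (Nat.pow_le_pow_right two_pos (Nat.not_lt.1 hk)))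
  simp [this] at h

theorem holds_bit {j : Expr} :
    (x.bit j).Holds W d s ↔ (x.value W s).testBit (j.eval s) = true := by
  cases x with
  | pos e =>
    rw [bit, Template.Holds, Template.Holds, value, testBit_wordValue, Expr.eval, Expr.eval,
      Expr.eval]
    split_ifs with h
    · rw [and_iff_right (by omega)]
    · simp only [Template.holds_fls, false_iff, not_and]
      exact fun h' => absurd h' (by omega)
  | const c =>
    simp only [bit, Template.holds_disj, List.mem_map, List.mem_filter, List.mem_range, value]
    constructor
    · rintro ⟨_, ⟨k, ⟨-, hk⟩, rfl⟩, h⟩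
      rwa [Template.holds_eq.1 h]
    · exact fun h => ⟨_, ⟨_, ⟨testBit_const_imp_lt h, h⟩, rfl⟩, Template.holds_eq.2 rfl⟩

theorem bitBound_of_testBit {j : ℕ} (hs : s 1 ≤ s 0) (h : (x.value W s).testBit j = true) :
    j < s 0 ∨ j < x.bitBound := by
  cases x with
  | pos e => exact Or.inl ((testBit_wordValue.1 h).1.trans_le hs)
  | const c => exact Or.inr (testBit_const_imp_lt h)

/-- The loop compares the bits below `n`, which suffices for numbers read from the input because `w
≤ n`. A fixed constant may have more than `n` bits on short inputs; the finite conjunction takes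
care of those. -/
theorem holds_eq (hx : x.Below d) (hy : y.Below d) (hd : 1 < d) (hs : s 1 ≤ s 0) :
    (x.eq d y).Holds W d s ↔ x.value W s = y.value W s := by
  simp only [eq, Template.Holds, Template.holds_iff, Template.holds_conj, List.mem_map,
    List.mem_range, forall_exists_index, and_imp, forall_apply_eq_imp_iff₂, holds_bit,
    hx.value_update hd, hy.value_update hd, Expr.eval, Function.update_self]
  constructor
  · rintro ⟨h1, h2⟩
    refine Nat.eq_of_testBit_eq fun j => Bool.eq_iff_iff.2 ?_
    by_cases hj : j < s 0
    · exact h1 j hj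
    by_cases hj' : j < max x.bitBound y.bitBound
    · exact h2 j hj'
    rw [lt_max_iff, not_or] at hj'
    refine iff_of_false (fun h => ?_) fun h => ?_
    · exact (bitBound_of_testBit hs h).elim hj hj'.1
    · exact (bitBound_of_testBit hs h).elim hj hj'.2
  · intro h
    simp [h]

end Elem

/-! ## Templates for encoded databases -/

variable {S : Signature} {deps : List (Dependency S)}

/-- The length of the encoding of a fact. -/
def recordLengthExpr (deps : List (Dependency S)) : Expr :=
  .add (.const (1 + (predList deps).length)) (.mul (.const (maxArity deps)) (.reg 1))

/-- The position of the record number `j`. -/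
def recordPos (deps : List (Dependency S)) (j : Expr) : Expr :=
  .add (.add (.reg 1) (.const 1)) (.mul j (recordLengthExpr deps))

/-- The argument number `i` of the record at position `a`. -/
def recordArg (deps : List (Dependency S)) (a : Expr) (i : ℕ) : Elem :=
  .pos (.add (.add (.add a (.const 1)) (.const (predList deps).length))
    (.mul (.const i) (.reg 1)))

theorem eval_recordPos (j : Expr) (s : ℕ → ℕ) :
    (recordPos deps j).eval s = s 1 + 1 + j.eval s * recordLength deps (s 1) := rfl

theorem below_recordPos {j : Expr} {d : ℕ} (hj : j.Below d) (hd : 1 < d) :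
    (recordPos deps j).Below d := ⟨⟨hd, trivial⟩, hj, trivial, trivial, hd⟩

theorem below_recordArg {a : Expr} {d : ℕ} (ha : a.Below d) (hd : 1 < d) (i : ℕ) :
    (recordArg deps a i).Below d := ⟨⟨⟨ha, trivial⟩, trivial⟩, trivial, hd⟩

theorem value_recordArg (W : List Bool) (s : ℕ → ℕ) (a : Expr) (i : ℕ) :
    (recordArg deps a i).value W s =
      wordValue W (s 1) (a.eval s + 1 + (predList deps).length + i * s 1) := rfl

/-- A fact that may occur in an encoded pair of databases. -/
def Encodable (deps : List (Dependency S)) (w : ℕ) (e : Bool × Fact S) : Prop :=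
  (∀ i, e.2.args i < 2 ^ w) ∧ e.2.pred ∈ predList deps ∧ e.2.pred ≠ S.bot

/-- The input contains a well-formed record at position `a`. -/
def recordTemplate (deps : List (Dependency S)) (d : ℕ) (a : Expr) : Template :=
  .disj (((predList deps).filter (· ≠ S.bot)).map fun p => .and
    (.conj (List.ofFn fun k : Fin (predList deps).length =>
      .lit (decide (p = (predList deps)[(k : ℕ)])) (.add (.add a (.const 1)) (.const k))))
    (.conj (((List.range (maxArity deps)).filter (S.arity p ≤ ·)).map fun i =>
      (recordArg deps a i).eq d (.const 0))))

/-- Any mark and any `w`-bit arguments are admissible, so the fact can be read off from the word.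
Only the predicate code and the zero padding of the slots beyond the arity have to be checked. -/
theorem holds_recordTemplate {W : List Bool} {d : ℕ} {s : ℕ → ℕ} {a : Expr} (ha : a.Below d)
    (hd : 1 < d) (hs : s 1 ≤ s 0) : (recordTemplate deps d a).Holds W d s ↔
      ∃ e, Encodable deps (s 1) e ∧ RecordAt deps W (s 1) (a.eval s) e := by
  have heq : ∀ i, ((recordArg deps a i).eq d (.const 0)).Holds W d s ↔
      wordValue W (s 1) (a.eval s + 1 + (predList deps).length + i * s 1) = 0 := fun i =>
    Elem.holds_eq (below_recordArg ha hd i) trivial hd hs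
  simp only [recordTemplate, Template.holds_disj, List.mem_map, List.mem_filter,
    exists_exists_and_eq_and, Template.Holds, Template.holds_conj, forall_exists_index, and_imp,
    Template.holds_lit, decide_eq_true_eq, List.mem_range, List.mem_ofFn, forall_apply_eq_imp_iff, Expr.eval]
  constructor
  · rintro ⟨p, ⟨hp, hbot⟩, h1, h2⟩
    have hargs : ∀ i : Fin (S.arity p),
        wordValue W (s 1) (a.eval s + 1 + (predList deps).length + i * s 1) < 2 ^ s 1 :=
      fun i => wordValue_lt _ _ _
    refine ⟨(W.getD (a.eval s) false, ⟨p, fun i =>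
      wordValue W (s 1) (a.eval s + 1 + (predList deps).length + i * s 1)⟩),
      ⟨hargs, hp, hbot⟩, (recordAt_iff hargs).2 ⟨rfl, fun k hk => h1 ⟨k, hk⟩, fun i hi => ?_⟩⟩
    unfold Fact.argD
    split_ifs with h
    · rfl
    · exact (heq i).1 (h2 _ i hi (Nat.not_lt.1 h) rfl)
  · rintro ⟨e, ⟨hargs, hp, hbot⟩, hrec⟩
    obtain ⟨-, h2, h3⟩ := (recordAt_iff hargs).1 hrec
    refine ⟨e.2.pred, ⟨hp, hbot⟩, fun k => h2 k k.2, ?_⟩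
    rintro _ i hi hle rfl
    rw [heq, h3 i hi, Fact.argD, dif_neg (Nat.not_lt.2 hle)]

/-- The input is the encoding of a list of facts, with constants of `w` bits, where `w` is
the value of register `1`; registers `2` and above are free. -/
def encodingTemplate (deps : List (Dependency S)) : Template :=
  .and (.ex (.eq (recordPos deps (.reg 2)) (.reg 0))) <|
  .and (.all (.or (.not (.lt (.reg 2) (.reg 1))) (.lit true (.reg 2)))) <|
  .and (.lit false (.reg 1)) <|
    .all (.or (.not (.lt (recordPos deps (.reg 2)) (.reg 0)))
      (recordTemplate deps 3 (recordPos deps (.reg 2))))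

/-- The number of records is guessed as a loop variable. It is less than `n` because records are
nonempty and the word also contains the separator after the prefix of ones. The list of facts is
then assembled by choosing one fact for each record position. -/
theorem holds_encodingTemplate {W : List Bool} {s : ℕ → ℕ} (h0 : s 0 = W.length)
    (h1 : s 1 < W.length) : (encodingTemplate deps).Holds W 2 s ↔
      ∃ es, W = encode deps (s 1) es ∧ ∀ e ∈ es, Encodable deps (s 1) e := by
  have hu0 : ∀ i, Function.update s 2 i 0 = s 0 := fun i => Function.update_of_ne (by omega) _ _
  have hu1 : ∀ i, Function.update s 2 i 1 = s 1 := fun i => Function.update_of_ne (by omega) _ _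
  have hrec : ∀ j, (recordTemplate deps 3 (recordPos deps (.reg 2))).Holds W 3
      (Function.update s 2 j) ↔ ∃ e, Encodable deps (s 1) e ∧
        RecordAt deps W (s 1) (s 1 + 1 + j * recordLength deps (s 1)) e := by
    intro j
    rw [holds_recordTemplate (below_recordPos (by simp [Expr.Below]) (by omega)) (by omega)
      (by rw [hu0, hu1]; omega), eval_recordPos, hu1]
    simp [Expr.eval]
  simp only [encodingTemplate, Template.Holds, Template.holds_ex, Template.holds_or,
    Template.holds_lt, Template.holds_eq, Template.holds_lit, Nat.reduceAdd, hrec,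
    eval_recordPos, Expr.eval, hu0, hu1, Function.update_self, h0, eq_encode_iff]
  have hL := recordLength_pos (deps := deps) (s 1)
  constructor
  · rintro ⟨⟨N, -, hN⟩, hpre, hsep, hr⟩
    have hr' : ∀ j : Fin N, ∃ e, Encodable deps (s 1) e ∧
        RecordAt deps W (s 1) (s 1 + 1 + j * recordLength deps (s 1)) e := by
      intro j
      have hlt : (j : ℕ) * recordLength deps (s 1) < N * recordLength deps (s 1) :=
        Nat.mul_lt_mul_of_pos_right j.2 hL
      have hle : (j : ℕ) ≤ j * recordLength deps (s 1) := Nat.le_mul_of_pos_right _ hL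
      exact (hr j (by omega)).resolve_left (not_not.2 (by omega))
    choose e he using hr'
    refine ⟨List.ofFn e, ⟨by simp [hN], fun j hj => ?_, hsep, fun j hj => ?_⟩, ?_⟩
    · exact (hpre j (by omega)).resolve_left (not_not.2 hj)
    · rw [List.getElem_ofFn]
      exact (he ⟨j, by simpa using hj⟩).2
    · intro x hx
      obtain ⟨j, rfl⟩ := List.mem_ofFn.1 hx
      exact (he j).1
  · rintro ⟨es, ⟨hlen, hpre, hsep, hr⟩, hes⟩
    have hle : es.length ≤ es.length * recordLength deps (s 1) := Nat.le_mul_of_pos_right _ hL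
    refine ⟨⟨es.length, by omega, hlen.symm⟩, fun j _ => ?_, hsep, fun j _ => ?_⟩
    · by_cases hj : j < s 1
      exacts [Or.inr (hpre j hj), Or.inl hj]
    · by_cases hj : j < es.length
      · exact Or.inr ⟨_, hes _ (List.getElem_mem hj), hr j hj⟩
      · left
        have := Nat.mul_le_mul_right (recordLength deps (s 1)) (Nat.not_lt.1 hj)
        omega

/-! ## Templates for first-order formulas -/

/-- The element described by a term. -/
def Term.elem (ρ : Var → Elem) : Term → Elem
  | var x => ρ x
  | const c => .const c

/-- The fact `p(x)`, marked with `b`, is encoded in the input. -/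
def factTemplate (deps : List (Dependency S)) (d : ℕ) (b : Bool) (p : S.Pred)
    (x : Fin (S.arity p) → Elem) : Template :=
  if p ∈ predList deps then
    .ex <| .and (.lit b (recordPos deps (.reg d))) <|
      .and (.lit true (.add (.add (recordPos deps (.reg d)) (.const 1))
        (.const ((predList deps).idxOf p)))) <|
      .conj (List.ofFn fun i => (x i).eq (d + 1) (recordArg deps (recordPos deps (.reg d)) i))
  else .fls

/-- The evaluation of a formula over the encoded databases, the quantifiers ranging over the
numbers written in the input and over the constants in `l`. -/
def formulaTemplate (deps : List (Dependency S)) (l : List Const) :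
    ℕ → (Var → Elem) → Formula S.withAux → Template
  | _, _, .fls => .fls
  | d, ρ, .atom ⟨Sum.inl p, t⟩ => factTemplate deps d false p fun i => (t i).elem ρ
  | d, ρ, .atom ⟨Sum.inr p, t⟩ => factTemplate deps d true p fun i => (t i).elem ρ
  | d, ρ, .eq s t => (s.elem ρ).eq d (t.elem ρ)
  | d, ρ, .neg φ => .not (formulaTemplate deps l d ρ φ)
  | d, ρ, .and φ ψ => .and (formulaTemplate deps l d ρ φ) (formulaTemplate deps l d ρ ψ)
  | d, ρ, .ex x φ => .or
      (.ex (formulaTemplate deps l (d + 1) (Function.update ρ x (.pos (.reg d))) φ))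
      (.disj (l.map fun c => formulaTemplate deps l d (Function.update ρ x (.const c)) φ))

-- Correctness of the fact and formula templates

section

variable {W : List Bool} {s : ℕ → ℕ} {es : List (Bool × Fact S)} {d : ℕ}

theorem Term.below_elem {ρ : Var → Elem} (hρ : ∀ x, (ρ x).Below d) (t : Term) :
    (t.elem ρ).Below d := by
  cases t with
  | var x => exact hρ x
  | const c => trivial

theorem Term.value_elem (ρ : Var → Elem) (t : Term) :
    (t.elem ρ).value W s = t.eval fun x => (ρ x).value W s := by
  cases t <;> rfl

theorem holds_factTemplate (h0 : s 0 = W.length) (h1 : s 1 < W.length)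
    (hW : W = encode deps (s 1) es) (hes : ∀ e ∈ es, Encodable deps (s 1) e) (hd : 1 < d)
    (b : Bool) (p : S.Pred) (x : Fin (S.arity p) → Elem) (hx : ∀ i, (x i).Below d) :
    (factTemplate deps d b p x).Holds W d s ↔ (b, ⟨p, fun i => (x i).value W s⟩) ∈ es := by
  unfold factTemplate
  by_cases hp : p ∈ predList deps
  swap
  · rw [if_neg hp]
    exact iff_of_false Template.holds_fls fun h => hp (hes _ h).2.1
  obtain ⟨hlen, -, -, hrec⟩ := eq_encode_iff.1 hW
  have hL := recordLength_pos (deps := deps) (s 1)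
  have hidx : (predList deps).idxOf p < (predList deps).length := List.idxOf_lt_length_of_mem hp
  have hu0 : ∀ i, Function.update s d i 0 = s 0 := fun i => Function.update_of_ne (by omega) _ _
  have hu1 : ∀ i, Function.update s d i 1 = s 1 := fun i => Function.update_of_ne (by omega) _ _
  have heq : ∀ j i, ((x i).eq (d + 1) (recordArg deps (recordPos deps (.reg d)) i)).Holds W (d + 1)
      (Function.update s d j) ↔ (x i).value W s = wordValue W (s 1)
        (s 1 + 1 + j * recordLength deps (s 1) + 1 + (predList deps).length + i * s 1) := by
    intro j i
    have hreg : (Expr.reg d).Below (d + 1) := Nat.lt_succ_self d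
    have hle : Function.update s d j 1 ≤ Function.update s d j 0 := by
      rw [hu0, hu1]; omega
    rw [Elem.holds_eq ((hx i).mono (Nat.le_succ d))
      (below_recordArg (below_recordPos hreg (by omega)) (by omega) _) (by omega) hle, (hx i).value_update hd, value_recordArg, eval_recordPos, hu1]
    simp [Expr.eval]
  rw [if_pos hp]
  simp only [Template.holds_ex, Template.Holds, Template.holds_lit, Template.holds_conj,
    List.mem_ofFn, forall_exists_index, forall_apply_eq_imp_iff, heq, Expr.eval, eval_recordPos,
    hu1, Function.update_self]
  constructor
  · rintro ⟨j, hj, hmark, hpred, hargs⟩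
    by_cases hjlt : j < es.length
    · obtain ⟨g1, g2, g3⟩ := (recordAt_iff (hes _ (List.getElem_mem hjlt)).1).1 (hrec j hjlt)
      rw [g1] at hmark
      rw [g2 _ hidx, List.getElem_idxOf hidx, decide_eq_true_eq] at hpred
      have hmem := List.getElem_mem hjlt
      obtain ⟨⟨b', p', t⟩, hej⟩ : ∃ e, es[j] = e := ⟨_, rfl⟩
      rw [hej] at hmark hpred hmem g3
      simp only at hmark hpred
      subst hmark hpred
      convert hmem using 3
      funext i
      rw [hargs i, g3 i (i.2.trans_le (arity_le_maxArity hp)), Fact.argD, dif_pos i.2]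
    -- The loop index also runs past the last record. There the word is read with default `false`,
    -- so the predicate bit, required to be `true`, rejects; the mark alone would not when `b` is
    -- `false`.
    · have := Nat.mul_le_mul_right (recordLength deps (s 1)) (Nat.not_lt.1 hjlt)
      rw [List.getD_eq_default _ _ (by omega)] at hpred
      simp at hpred
  · intro hmem
    obtain ⟨j, hj, hej⟩ := List.getElem_of_mem hmem
    obtain ⟨g1, g2, g3⟩ := (recordAt_iff (hes _ (List.getElem_mem hj)).1).1 (hrec j hj)
    rw [hej] at g1 g2 g3
    have hle : es.length ≤ es.length * recordLength deps (s 1) := Nat.le_mul_of_pos_right _ hL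
    refine ⟨j, by omega, g1, ?_, fun i => ?_⟩
    · rw [g2 _ hidx, List.getElem_idxOf hidx, decide_eq_true_eq]
    · rw [g3 i (i.2.trans_le (arity_le_maxArity hp)), Fact.argD, dif_pos i.2]

/-- A quantifier becomes a loop over all positions, including those where no argument starts,
together with a disjunction over `l`. The spurious numbers read at such positions merely enlarge the
quantifier domain. -/
theorem holds_formulaTemplate (h0 : s 0 = W.length) (h1 : s 1 < W.length)
    (hW : W = encode deps (s 1) es) (hes : ∀ e ∈ es, Encodable deps (s 1) e) (hd : 1 < d)
    (l : List Const) (φ : Formula S.withAux) (ρ : Var → Elem) (hρ : ∀ x, (ρ x).Below d) :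
    (formulaTemplate deps l d ρ φ).Holds W d s ↔
      φ.SatIn ({c | c ∈ l} ∪ {c | ∃ q < W.length, wordValue W (s 1) q = c})
        (pairInstance {f | (false, f) ∈ es} {f | (true, f) ∈ es})
        fun x => (ρ x).value W s := by
  induction φ generalizing d s ρ with
  | fls => exact iff_of_false Template.holds_fls id
  | atom a =>
    obtain ⟨p | p, t⟩ := a
    · refine (holds_factTemplate h0 h1 hW hes hd false p (fun i => (t i).elem ρ)
        fun i => Term.below_elem hρ _).trans ?_
      simp only [Term.value_elem]
      exact (plain_mem_pairInstance (D := {f | (false, f) ∈ es}) (D' := {f | (true, f) ∈ es})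
        (f := ⟨p, fun i => (t i).eval fun x => (ρ x).value W s⟩)).symm
    · refine (holds_factTemplate h0 h1 hW hes hd true p (fun i => (t i).elem ρ)
        fun i => Term.below_elem hρ _).trans ?_
      simp only [Term.value_elem]
      exact (aux_mem_pairInstance (D := {f | (false, f) ∈ es}) (D' := {f | (true, f) ∈ es})
        (f := ⟨p, fun i => (t i).eval fun x => (ρ x).value W s⟩)).symm
  | eq t u =>
    rw [formulaTemplate, Elem.holds_eq (Term.below_elem hρ _) (Term.below_elem hρ _) hd
      (by omega), Term.value_elem, Term.value_elem]
    rfl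
  | neg φ ih =>
    simp only [formulaTemplate, Template.Holds, Formula.SatIn, ih h0 h1 hW hes hd ρ hρ]
  | and φ ψ ih₁ ih₂ =>
    simp only [formulaTemplate, Template.Holds, Formula.SatIn, ih₁ h0 h1 hW hes hd ρ hρ,
      ih₂ h0 h1 hW hes hd ρ hρ]
  | ex x φ ih =>
    have hu0 : ∀ i, Function.update s d i 0 = s 0 := fun i =>
      Function.update_of_ne (by omega) _ _
    have hu1 : ∀ i, Function.update s d i 1 = s 1 := fun i =>
      Function.update_of_ne (by omega) _ _
    have hpos : ∀ q, (formulaTemplate deps l (d + 1)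
        (Function.update ρ x (.pos (.reg d))) φ).Holds W (d + 1) (Function.update s d q) ↔
        φ.SatIn ({c | c ∈ l} ∪ {c | ∃ q < W.length, wordValue W (s 1) q = c})
          (pairInstance {f | (false, f) ∈ es} {f | (true, f) ∈ es})
          (Function.update (fun x => (ρ x).value W s) x (wordValue W (s 1) q)) := by
      intro q
      rw [ih (s := Function.update s d q) (by rw [hu0, h0]) (by rwa [hu1]) (by rwa [hu1])
        (by rwa [hu1]) (by omega), hu1]
      · congr! 1
        funext y
        by_cases hy : y = x
        · subst hy
          simp [Elem.value, Expr.eval, hu1]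
        · rw [Function.update_of_ne hy, Function.update_of_ne hy, (hρ y).value_update hd]
      · intro y
        by_cases hy : y = x
        · subst hy
          rw [Function.update_self]
          exact Nat.lt_succ_self d
        · rw [Function.update_of_ne hy]
          exact (hρ y).mono (Nat.le_succ d)
    have hconst : ∀ c, (formulaTemplate deps l d (Function.update ρ x (.const c)) φ).Holds W d s ↔
        φ.SatIn ({c | c ∈ l} ∪ {c | ∃ q < W.length, wordValue W (s 1) q = c})
          (pairInstance {f | (false, f) ∈ es} {f | (true, f) ∈ es})
          (Function.update (fun x => (ρ x).value W s) x c) := by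
      intro c
      rw [ih h0 h1 hW hes hd]
      · congr! 1
        funext y
        by_cases hy : y = x
        · subst hy
          simp [Elem.value]
        · rw [Function.update_of_ne hy, Function.update_of_ne hy]
      · intro y
        by_cases hy : y = x
        · subst hy
          rw [Function.update_self]
          trivial
        · rw [Function.update_of_ne hy]
          exact hρ y
    simp only [formulaTemplate, Template.holds_or, Template.holds_ex, Template.holds_disj,
      List.mem_map, exists_exists_and_eq_and, hpos, hconst, h0, Formula.SatIn, Set.mem_union,
      or_and_right, exists_or, Set.mem_ofPred_eq]
    rw [or_comm]

end

/-! ## Repair checking is in AC⁰ -/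

/-- Reading beyond the end gives `0`, which is why `0` must be in `l`. This does occur: for `w = 0`
the empty argument slots of the last record start at position `W.length`. -/
theorem wordValue_mem {W : List Bool} {l : List Const} (hl : 0 ∈ l) {w : ℕ} (q : ℕ) :
    wordValue W w q ∈ {c | c ∈ l} ∪ {c | ∃ q < W.length, wordValue W w q = c} := by
  by_cases hq : q < W.length
  · exact Or.inr ⟨q, hq, rfl⟩
  · left
    rw [(wordValue_eq_iff (Nat.two_pow_pos w)).2 fun j _ => ?_]
    · exact hl
    · rw [List.getD_eq_default _ _ (by omega), Nat.zero_testBit]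

theorem isDatabaseOver_of_encodable {w : ℕ} {es : List (Bool × Fact S)}
    (hes : ∀ e ∈ es, Encodable deps w e) (b : Bool) :
    IsDatabaseOver deps {f | (b, f) ∈ es} :=
  ⟨⟨es.finite_toSet.preimage (Prod.mk_right_injective b).injOn, fun _ hf => (hes _ hf).2.2⟩,
    fun _ hf => (hes _ hf).2.1⟩

/-- The prefix `1ʷ0` forces `w` below the length of the word, so the bit width can be guessed by a
template loop. -/
theorem mem_repairLanguage_iff {W : List Bool} : W ∈ repairLanguage deps ↔
    ∃ w < W.length, ∃ es, (W = encode deps w es ∧ ∀ e ∈ es, Encodable deps w e) ∧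
      IsRepair deps {f | (false, f) ∈ es} {f | (true, f) ∈ es} := by
  constructor
  · rintro ⟨D, D', hD, hD', ⟨w, es, hargs, rfl, rfl, rfl⟩, hrep⟩
    refine ⟨w, ?_, es, ⟨rfl, ?_⟩, hrep⟩
    · simp [encode]
    · rintro ⟨_ | _, f⟩ he
      · exact ⟨hargs _ he, hD.2 f he, hD.1.2 f he⟩
      · exact ⟨hargs _ he, hD'.2 f he, hD'.1.2 f he⟩
  · rintro ⟨w, -, es, ⟨rfl, hes⟩, hrep⟩
    have hdb := isDatabaseOver_of_encodable hes
    exact ⟨_, _, hdb false, hdb true, ⟨w, es, fun e he => (hes e he).1, rfl, rfl, rfl⟩, hrep⟩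

theorem inAC0_repairLanguage {Φ : Formula S.withAux} (hΦ : IsRepairRewriting deps Φ) :
    InAC0 (repairLanguage deps) := by
  obtain ⟨hfree, hΦ⟩ := hΦ
  -- Besides covering reads past the end, `0` makes the quantifier domain nonempty, as domain
  -- independence requires.
  have hfin : (insert 0 Φ.consts).Finite := Φ.finite_consts.insert 0
  refine inAC0_of_template (.ex (.and (encodingTemplate deps)
    (formulaTemplate deps hfin.toFinset.toList 2 (fun _ => .const 0) Φ))) fun W => ?_
  rw [mem_repairLanguage_iff, Template.holds_ex]
  simp only [Function.update_self, Nat.reduceAdd, Template.Holds]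
  refine exists_congr fun w => and_congr_right fun hw => ?_
  generalize hs : Function.update (Function.update (fun _ => 0) 0 W.length) 1 w = s
  have h0 : s 0 = W.length := by rw [← hs]; simp
  obtain rfl : s 1 = w := by rw [← hs]; simp
  rw [holds_encodingTemplate h0 hw]
  -- The template side does not mention `es`, so testing for an encoding and evaluating the sentence
  -- can be done separately. The initial assignment is arbitrary because `Φ` is closed.
  have key : ∀ es, (W = encode deps (s 1) es ∧ ∀ e ∈ es, Encodable deps (s 1) e) →
      (IsRepair deps {f | (false, f) ∈ es} {f | (true, f) ∈ es} ↔
        (formulaTemplate deps hfin.toFinset.toList 2 (fun _ => .const 0) Φ).Holds W 2 s) := by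
    rintro es ⟨hW, hes⟩
    rw [holds_formulaTemplate h0 hw hW hes one_lt_two _ _ (fun _ => .const 0) fun _ => trivial]
    have hdb := isDatabaseOver_of_encodable hes
    obtain ⟨hdi, hsat⟩ := hΦ _ _ (hdb false) (hdb true)
    rw [hdi _ _ ⟨0, Or.inl (by simp)⟩ ?_ ?_ (by simp [hfree]), hsat]
    · obtain ⟨hlen, -, -, hrec⟩ := eq_encode_iff.1 hW
      have hocc : ∀ b, adom {f : Fact S | (b, f) ∈ es} ⊆ {c | c ∈ hfin.toFinset.toList} ∪
          {c | ∃ q < W.length, wordValue W (s 1) q = c} := by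
        rintro b c ⟨f, hf, i, rfl⟩
        obtain ⟨j, hj, hej⟩ := List.getElem_of_mem hf
        obtain ⟨-, -, g3⟩ := (recordAt_iff (hes _ (List.getElem_mem hj)).1).1 (hrec j hj)
        rw [hej] at g3
        have hval := g3 i (i.2.trans_le (arity_le_maxArity (hes _ hf).2.1))
        rw [Fact.argD, dif_pos i.2] at hval
        rw [← hval]
        exact wordValue_mem (by simp) _
      rw [adom_pairInstance]
      exact Set.union_subset (hocc false) (hocc true)
    · exact fun c hc => Or.inl (by simp [hc])
  constructor
  · rintro ⟨es, hes, hrep⟩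
    exact ⟨⟨es, hes⟩, (key es hes).1 hrep⟩
  · rintro ⟨⟨es, hes⟩, h⟩
    exact ⟨es, hes, (key es hes).2 h⟩

end RepairChecking

theorem mainTheorem2 (S : RepairChecking.Signature)
    (deps : List (RepairChecking.Dependency S))
    (hfull : ∀ d ∈ deps, d.IsFull)
    (hrew : RepairChecking.CQFORewritable deps) :
    (∀ R : S.Pred → RepairChecking.Formula S,
      (∀ p ∈ RepairChecking.predList deps,
        RepairChecking.IsRewriting deps (RepairChecking.CQ.atomic p) (R p)) →
      RepairChecking.IsRepairRewriting deps (RepairChecking.phiRc deps R)) ∧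
    RepairChecking.RepairCheckingFORewritable deps ∧
    RepairChecking.InAC0 (RepairChecking.repairLanguage deps) := by
  choose R hR using fun p => hrew (RepairChecking.CQ.atomic p)
  have hΦ := RepairChecking.isRepairRewriting_phiRc hfull fun p _ => hR p
  exact ⟨fun R hR => RepairChecking.isRepairRewriting_phiRc hfull hR, ⟨_, hΦ⟩,
    RepairChecking.inAC0_repairLanguage hΦ⟩
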